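/- For $N\in\mathbb N$ let $\mathcal Q_N=\{-1,1\}^N$, let $W=N(|-\rangle\langle-|-\mathbb 1)$ on $\ell^2(\mathcal Q_N)$ with $\langle\sigma|-\rangle=2^{-N/2}$ (the generator of the Markov jump process on $\mathcal Q_N$ in which every jump between two distinct configurations has rate $N2^{-N}$), and let $U$ be the random energy model: multiplication by independent Gaussian variables $U(\sigma)$, $\sigma\in\mathcal Q_N$, with mean $0$ and variance $N$; the models for all $N$ are defined on one probability space, with arbitrary dependence between different $N$. Let $\beta_c=\sqrt{2\ln 2}$, and $p_0(\beta)=\beta^2/2$ for $\beta\le\beta_c$, $p_0(\beta)=\beta\beta_c-\ln 2$ for $\beta>\beta_c$. (1) For all $T>0$ and $\lambda\ge 0$, for almost all realisations of $U$, $$\lim_{N\to\infty}\frac TN\ln\Big(2^{-N}\operatorname{Tr}e^{(W-\lambda U)/T}\Big)=f(T,\lambda):=\max\{-T\ln 2,\;T p_0(\lambda/T)-1\}.$$ (2) The quadrant $T>0$, $\lambda\ge0$ contains three non-empty, pairwise disjoint regions: * quantum paramagnet (QPM): $T\le\beta_c^{-2}$ and $\lambda<\beta_c^{-1}$, or $T>\beta_c^{-2}$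 and $\lambda^2<2T(1-T\ln 2)$; there $f(T,\lambda)=-T\ln 2$; * spin glass (SG): $\lambda>\beta_c^{-1}$ and $\lambda>\beta_cT$; there $f(T,\lambda)=\lambda\beta_c-T\ln2-1$; * classical paramagnet (PM): $\lambda<\beta_cT$ and $\lambda^2>2T(1-T\ln2)$; there $f(T,\lambda)=\frac{\lambda^2}{2T}-1$. For $T>0$ and $\lambda\ge0$, the function $f$, defined by the formula in (1) on a neighbourhood of $(T,\lambda)$ in $\mathbb R^2$, is real-analytic at $(T,\lambda)$ if and only if $(T,\lambda)$ lies in one of these three regions. -/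

import Mathlib

namespace AllToAllQREM

noncomputable section

open MeasureTheory ProbabilityTheory
open scoped NNReal

/-- Configurations of `N` Ising spins: `{-1, 1}^N` (the units of `ℤ` are exactly `1` and `-1`). -/
abbrev Config (N : ℕ) : Type := Fin N → ℤˣ

/-- The uniform all-to-all transition rate `w_{σ → τ} = N 2^{-N}` between distinct configurations. -/
def rate (N : ℕ) : ℝ := (N : ℝ) * ((2 : ℝ) ^ N)⁻¹

/-- The escape rate `r_σ`, the sum of the transition rates from `σ` to all other configurations. -/
def escapeRate (N : ℕ) (σ : Config N) : ℝ :=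
  ∑ _τ ∈ Finset.univ.erase σ, rate N

/-- The generator `W` of the all-to-all dynamics, as a matrix in the canonical basis. -/
def generator (N : ℕ) : Matrix (Config N) (Config N) ℝ :=
  Matrix.of fun τ σ => if τ = σ then -escapeRate N σ else rate N

/-- The flat state `|-⟩`, all of whose coordinates equal `2^{-N/2}`. -/
def flatState (N : ℕ) : Config N → ℝ := fun _ => (2 : ℝ) ^ (-(N : ℝ) / 2)

/-- The generator is `N (|-⟩⟨-| - 1)`. -/
theorem generator_eq (N : ℕ) :
    generator N =
      (N : ℝ) • (Matrix.vecMulVec (flatState N) (flatState N) - (1 : Matrix _ _ ℝ)) := by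
  have h2 : (2 : ℝ) ^ (-(N : ℝ) / 2) * (2 : ℝ) ^ (-(N : ℝ) / 2) = ((2 : ℝ) ^ N)⁻¹ := by
    rw [← Real.rpow_add (by norm_num), ← Real.rpow_natCast, ← Real.rpow_neg (by norm_num)]
    congr 1
    ring
  ext τ σ
  by_cases h : τ = σ
  · subst h
    have h3 : (2 : ℝ) ^ N ≠ 0 := by positivity
    simp [generator, escapeRate, rate, flatState, Matrix.vecMulVec_apply, h2,
      Finset.card_erase_of_mem]
    field_simp
    ring
  · simp [generator, rate, flatState, Matrix.vecMulVec_apply, h2, h]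

/-- `U` is a random energy model for every system size `N`: the energies `U N σ`, `σ ∈ {-1,1}^N`,
are independent centred Gaussians of variance `N`. Nothing is assumed on the joint law of the
energies of different system sizes. -/
structure IsREM {Ω : Type*} [MeasurableSpace Ω] (P : Measure Ω)
    (U : (N : ℕ) → Config N → Ω → ℝ) : Prop where
  hasLaw : ∀ N σ, HasLaw (U N σ) (gaussianReal 0 (N : ℝ≥0)) P
  indep : ∀ N, iIndepFun (U N) P

/-- The matrix `W_λ = W - λ U` for an energy function `U` on configurations, which acts as a
multiplication operator. -/
def tiltedGenerator (N : ℕ) (lam : ℝ) (U : Config N → ℝ) : Matrix (Config N) (Config N) ℝ :=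
  generator N - lam • Matrix.diagonal U

/-- `(T / N) ln (2^{-N} Tr exp((W - λ U) / T))`. -/
def finiteFreeEnergy (N : ℕ) (T lam : ℝ) (U : Config N → ℝ) : ℝ :=
  T / N * Real.log (((2 : ℝ) ^ N)⁻¹ *
    (NormedSpace.exp (T⁻¹ • tiltedGenerator N lam U)).trace)

/-- The critical inverse temperature `β_c = √(2 ln 2)` of the random energy model. -/
def betaC : ℝ := Real.sqrt (2 * Real.log 2)

/-- The pressure `p_0` of the random energy model. -/
def pressure (β : ℝ) : ℝ :=
  if β ≤ betaC then β ^ 2 / 2 else β * betaC - Real.log 2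

/-- The limiting free energy `f(T, λ) = max {-T ln 2, T p_0(λ / T) - 1}`. -/
def freeEnergy (T lam : ℝ) : ℝ :=
  max (-T * Real.log 2) (T * pressure (lam / T) - 1)

/-- The quantum paramagnetic phase, as a set of pairs `(T, λ)`. -/
def quantumParamagnet : Set (ℝ × ℝ) :=
  {p | 0 < p.1 ∧ 0 ≤ p.2 ∧
    ((p.1 ≤ 1 / betaC ^ 2 ∧ p.2 < 1 / betaC) ∨
      (1 / betaC ^ 2 < p.1 ∧ p.2 ^ 2 < 2 * p.1 * (1 - p.1 * Real.log 2)))}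

/-- The spin glass phase, as a set of pairs `(T, λ)`. -/
def spinGlass : Set (ℝ × ℝ) :=
  {p | 0 < p.1 ∧ 0 ≤ p.2 ∧ 1 / betaC < p.2 ∧ betaC * p.1 < p.2}

/-- The classical paramagnetic phase, as a set of pairs `(T, λ)`. -/
def classicalParamagnet : Set (ℝ × ℝ) :=
  {p | 0 < p.1 ∧ 0 ≤ p.2 ∧ p.2 < betaC * p.1 ∧
    2 * p.1 * (1 - p.1 * Real.log 2) < p.2 ^ 2}

end

end AllToAllQREM

/-!
The matrix `H = (W - λ U) / T` is a rank-one perturbation of a diagonal matrix: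
`H = a (|-⟩⟨-| - 1) - β U` with `a = N / T` and `β = λ / T`.

*Lower bounds.* Jensen's inequality for the spectral measure of `H` in a unit vector `x` gives
`exp ⟨x, H x⟩ ≤ ⟨x, e^H x⟩`. Used in the canonical basis, it yields
`2^{-N} Tr e^H ≥ e^{-N/T} Z(β)`, where `Z(β) = 2^{-N} ∑ exp(-β U(σ))` is the classical partition
function; used in the flat state, it yields `2^{-N} Tr e^H ≥ 2^{-N} e^{o(N)}`, because the
empirical mean of `U` is `o(N)`.

*Upper bound* (`trace_exp_rankOnePerturbation_le`). Almost surely, the set `L` of configurations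
with `U(σ) < -ε N` is an exponentially small fraction of all configurations. Hence the quadratic
form of `|-⟩⟨-|` is, up to `O(ε)`, that of its restriction to the complement of `L`. There
`-β U ≤ β ε N`, so that `H` is dominated by the direct sum of the diagonal matrix `-a - β U` on `L`
and a rank-one perturbation of a multiple of the identity. The trace of the exponential is
`∑ exp ⟨v, H v⟩` over eigenvectors `v` of `H`, and convexity of `exp`, applied to each term, bounds
it by the trace of the exponential of this direct sum, without any need to locate the spectrum:
`2^{-N} Tr e^H ≤ e^{O(ε) N} (e^{-N/T} Z(β) + 2^{-N} + e^{-N/T})`.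

*The random energy model.* Markov's inequality and the Borel–Cantelli lemma give
`Z(β) ≤ e^{N (β²/2 + ε)}` for every real `β`; beyond `β_c` the bound
`∑ exp(-β U) ≤ (∑ exp(-β_c U))^{β/β_c}` improves this to the frozen pressure. The same bound at
inverse temperatures of order `ε` controls the set `L` and the empirical mean of `U`. For the lower
bound, the number of `σ` with `-U(σ) ≥ a N`, where `0 ≤ a < β_c`, is at least half of its
exponentially large mean by Chebyshev's inequality, and `p_0(β)` is the supremum of `β a - a²/2`
over these `a`. All almost sure statements come from summable probabilities, so that the joint law of
the energies for different `N` is irrelevant.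

*Phase diagram.* Inside each phase `f` coincides near the point with one analytic expression. On a
boundary, a line through the point, in the direction of `λ` or `T`, meets two phases; by the
identity theorem, analyticity of `f` would force the two expressions to coincide along it
(`eventually_eq_of_analyticAt_of_sides`).
-/

namespace AllToAllQREM

open MeasureTheory ProbabilityTheory Filter Topology
open scoped NNReal

/-! ### Traces of exponentials of symmetric matrices -/

section Matrix

variable {n : Type*} [Fintype n] [DecidableEq n]

/-- The spectral theorem over `ℝ`, together with the resulting formula for the exponential. -/
theorem exists_orthogonal_diagonalization {A : Matrix n n ℝ} (hA : A.IsHermitian) :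
    ∃ (V : Matrix n n ℝ) (d : n → ℝ), V.transpose * V = 1 ∧ V * V.transpose = 1 ∧
      A = V * Matrix.diagonal d * V.transpose ∧
      NormedSpace.exp A = V * Matrix.diagonal (fun i => Real.exp (d i)) * V.transpose := by
  have h1 := (Matrix.mem_unitaryGroup_iff').1 hA.eigenvectorUnitary.2
  have h2 := (Matrix.mem_unitaryGroup_iff).1 hA.eigenvectorUnitary.2
  set V : Matrix n n ℝ := (hA.eigenvectorUnitary : Matrix n n ℝ) with hV
  rw [Matrix.star_eq_conjTranspose, Matrix.conjTranspose_eq_transpose_of_trivial] at h1 h2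
  have h3 : A = V * Matrix.diagonal hA.eigenvalues * V.transpose := by
    have := hA.spectral_theorem
    rw [Unitary.conjStarAlgAut_apply, Matrix.star_eq_conjTranspose,
      Matrix.conjTranspose_eq_transpose_of_trivial] at this
    exact this
  refine ⟨V, hA.eigenvalues, h1, h2, h3, ?_⟩
  have hinv : V⁻¹ = V.transpose := Matrix.inv_eq_right_inv h2
  have hunit : IsUnit V := IsUnit.of_mul_eq_one _ h2
  generalize hA.eigenvalues = d at h3
  rw [h3, ← hinv, Matrix.exp_conj _ _ hunit, Matrix.exp_diagonal]
  congr 3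
  ext i
  rw [Pi.coe_exp, Real.exp_eq_exp_ℝ]

theorem dotProduct_conj_mulVec (V : Matrix n n ℝ) (d x : n → ℝ) :
    x ⬝ᵥ (V * Matrix.diagonal d * V.transpose).mulVec x =
      ∑ i, d i * (V.transpose.mulVec x i) ^ 2 := by
  rw [Matrix.mul_assoc, ← Matrix.mulVec_mulVec, Matrix.dotProduct_mulVec,
    ← Matrix.mulVec_transpose, ← Matrix.mulVec_mulVec, dotProduct]
  refine Finset.sum_congr rfl fun i _ => ?_
  rw [Matrix.mulVec_diagonal]
  ring

/-- Jensen's inequality for the spectral measure of `A` in a unit vector. -/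
theorem exp_dotProduct_mulVec_le {A : Matrix n n ℝ} (hA : A.IsHermitian) {x : n → ℝ}
    (hx : x ⬝ᵥ x = 1) :
    Real.exp (x ⬝ᵥ A.mulVec x) ≤ x ⬝ᵥ (NormedSpace.exp A).mulVec x := by
  obtain ⟨V, d, -, h2, h3, h4⟩ := exists_orthogonal_diagonalization hA
  rw [h4, h3, dotProduct_conj_mulVec, dotProduct_conj_mulVec]
  have hw : ∑ i, (V.transpose.mulVec x i) ^ 2 = 1 := by
    have := dotProduct_conj_mulVec V (fun _ => 1) x
    simp only [Matrix.diagonal_one, Matrix.mul_one, h2, Matrix.one_mulVec, hx, one_mul] at this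
    exact this.symm
  have := convexOn_exp.map_sum_le (t := Finset.univ) (w := fun i => (V.transpose.mulVec x i) ^ 2)
    (p := d) (fun i _ => sq_nonneg _) hw (fun _ _ => Set.mem_univ _)
  simp only [smul_eq_mul] at this
  simpa only [mul_comm] using this

theorem dotProduct_exp_mulVec_le_trace {A : Matrix n n ℝ} (hA : A.IsHermitian) {x : n → ℝ}
    (hx : x ⬝ᵥ x = 1) :
    x ⬝ᵥ (NormedSpace.exp A).mulVec x ≤ (NormedSpace.exp A).trace := by
  obtain ⟨V, d, h1, h2, h3, h4⟩ := exists_orthogonal_diagonalization hA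
  rw [h4, dotProduct_conj_mulVec, Matrix.trace_mul_comm, ← Matrix.mul_assoc, h1, Matrix.one_mul,
    Matrix.trace_diagonal]
  have hw : ∑ i, (V.transpose.mulVec x i) ^ 2 = 1 := by
    have := dotProduct_conj_mulVec V (fun _ => 1) x
    simp only [Matrix.diagonal_one, Matrix.mul_one, h2, Matrix.one_mulVec, hx, one_mul] at this
    exact this.symm
  refine Finset.sum_le_sum fun i _ => ?_
  have : (V.transpose.mulVec x i) ^ 2 ≤ 1 := by
    rw [← hw]
    exact Finset.single_le_sum (f := fun i => (V.transpose.mulVec x i) ^ 2)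
      (fun j _ => sq_nonneg _) (Finset.mem_univ i)
  exact mul_le_of_le_one_right (Real.exp_pos _).le this

/-- The Peierls inequality in a single unit vector. -/
theorem exp_dotProduct_mulVec_le_trace {A : Matrix n n ℝ} (hA : A.IsHermitian) {x : n → ℝ}
    (hx : x ⬝ᵥ x = 1) :
    Real.exp (x ⬝ᵥ A.mulVec x) ≤ (NormedSpace.exp A).trace :=
  (exp_dotProduct_mulVec_le hA hx).trans (dotProduct_exp_mulVec_le_trace hA hx)

/-- The Peierls inequality in the canonical basis. -/
theorem sum_exp_diag_le_trace {A : Matrix n n ℝ} (hA : A.IsHermitian) :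
    ∑ i, Real.exp (A i i) ≤ (NormedSpace.exp A).trace := by
  refine Finset.sum_le_sum fun i _ => ?_
  have := exp_dotProduct_mulVec_le hA (x := Pi.single i 1) (by simp)
  simpa using this

/-- The trace of the exponential is the sum of `exp ⟨v, A v⟩` over an orthonormal basis of
eigenvectors `v`. -/
theorem exists_trace_exp_eq {A : Matrix n n ℝ} (hA : A.IsHermitian) :
    ∃ v : n → n → ℝ, (∀ i, v i ⬝ᵥ v i = 1) ∧
      (∀ x : n → ℝ, ∑ i, (x ⬝ᵥ v i) ^ 2 = x ⬝ᵥ x) ∧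
      (NormedSpace.exp A).trace = ∑ i, Real.exp (v i ⬝ᵥ A.mulVec (v i)) := by
  obtain ⟨V, d, h1, h2, h3, h4⟩ := exists_orthogonal_diagonalization hA
  have hV : ∀ i j, (∑ k, V k i * V k j) = (1 : Matrix n n ℝ) i j := by
    intro i j
    rw [← h1, Matrix.mul_apply]
    rfl
  refine ⟨fun i => V.transpose i, fun i => ?_, fun x => ?_, ?_⟩
  · simpa [dotProduct, Matrix.one_apply] using hV i i
  · have := dotProduct_conj_mulVec V (fun _ => 1) x
    simp only [Matrix.diagonal_one, Matrix.mul_one, h2, Matrix.one_mulVec, one_mul] at this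
    rw [this]
    simp only [Matrix.mulVec, dotProduct_comm]
  · have : ∀ i, V.transpose i ⬝ᵥ A.mulVec (V.transpose i) = d i := by
      intro i
      rw [h3, dotProduct_conj_mulVec]
      have : ∀ j, V.transpose.mulVec (V.transpose i) j = (1 : Matrix n n ℝ) j i := by
        intro j
        rw [← hV j i]
        rfl
      simp [this, Matrix.one_apply]
    simp only [this]
    rw [h4, Matrix.trace_mul_comm, ← Matrix.mul_assoc, h1, Matrix.one_mul, Matrix.trace_diagonal]

/-- The matrix `a (|φ⟩⟨φ| - 1) + diag g`. -/
def rankOnePerturbation {n : Type*} [DecidableEq n] (a : ℝ) (φ g : n → ℝ) : Matrix n n ℝ :=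
  a • (Matrix.vecMulVec φ φ - 1) + Matrix.diagonal g

theorem isHermitian_rankOnePerturbation {n : Type*} [DecidableEq n] (a : ℝ) (φ g : n → ℝ) :
    (rankOnePerturbation a φ g).IsHermitian := by
  ext i j
  by_cases h : i = j
  · subst h; simp
  · simp [rankOnePerturbation, Matrix.vecMulVec_apply, h, Ne.symm h, mul_comm]

theorem dotProduct_rankOnePerturbation_mulVec (a : ℝ) (φ g x : n → ℝ) :
    x ⬝ᵥ (rankOnePerturbation a φ g).mulVec x =
      a * ((φ ⬝ᵥ x) ^ 2 - x ⬝ᵥ x) + ∑ i, g i * x i ^ 2 := by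
  have h1 : (Matrix.vecMulVec φ φ).mulVec x = (φ ⬝ᵥ x) • φ := by
    ext i
    simp [Matrix.mulVec, dotProduct, Matrix.vecMulVec_apply, Finset.sum_mul]
    exact Finset.sum_congr rfl fun j _ => by ring
  have h2 : x ⬝ᵥ (Matrix.diagonal g).mulVec x = ∑ i, g i * x i ^ 2 := by
    simp only [dotProduct, Matrix.mulVec_diagonal]
    exact Finset.sum_congr rfl fun i _ => by ring
  rw [rankOnePerturbation, Matrix.add_mulVec, Matrix.smul_mulVec, Matrix.sub_mulVec,
    Matrix.one_mulVec, h1, dotProduct_add, h2, dotProduct_smul, dotProduct_sub, dotProduct_smul,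
    dotProduct_comm x φ]
  simp only [smul_eq_mul]
  ring

/-- Convexity of `exp` for a finite family of weights and two further weights, of total mass `1`. -/
theorem exp_sum_add_add_le {ι : Type*} (s : Finset ι) (w y : ι → ℝ) {q r y₁ y₂ : ℝ}
    (hw : ∀ i ∈ s, 0 ≤ w i) (hq : 0 ≤ q) (hr : 0 ≤ r) (h : ∑ i ∈ s, w i + q + r = 1) :
    Real.exp (∑ i ∈ s, w i * y i + q * y₁ + r * y₂) ≤
      ∑ i ∈ s, w i * Real.exp (y i) + q * Real.exp y₁ + r * Real.exp y₂ := by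
  set X := ∑ i ∈ s, w i * y i + q * y₁ + r * y₂ with hX
  -- the tangent line of `exp` at the barycentre `X`
  have key : ∀ y, Real.exp X * (1 + y - X) ≤ Real.exp y := by
    intro y
    have h1 := Real.add_one_le_exp (y - X)
    have h2 : Real.exp y = Real.exp X * Real.exp (y - X) := by
      rw [← Real.exp_add]; congr 1; ring
    rw [h2]
    exact mul_le_mul_of_nonneg_left (by linarith) (Real.exp_pos _).le
  have h1 : ∑ i ∈ s, w i * (Real.exp X * (1 + y i - X)) ≤ ∑ i ∈ s, w i * Real.exp (y i) :=
    Finset.sum_le_sum fun i hi => mul_le_mul_of_nonneg_left (key _) (hw i hi)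
  have h2 : ∑ i ∈ s, w i * (Real.exp X * (1 + y i - X)) =
      Real.exp X * ((∑ i ∈ s, w i) * (1 - X) + ∑ i ∈ s, w i * y i) := by
    rw [Finset.sum_mul, ← Finset.sum_add_distrib, Finset.mul_sum]
    exact Finset.sum_congr rfl fun i _ => by ring
  have h3 := mul_le_mul_of_nonneg_left (key y₁) hq
  have h4 := mul_le_mul_of_nonneg_left (key y₂) hr
  have h5 : Real.exp X * ((∑ i ∈ s, w i) * (1 - X) + ∑ i ∈ s, w i * y i)
      + q * (Real.exp X * (1 + y₁ - X)) + r * (Real.exp X * (1 + y₂ - X)) = Real.exp X := by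
    have e1 : ∑ i ∈ s, w i = 1 - q - r := by linarith
    have e2 : ∑ i ∈ s, w i * y i = X - q * y₁ - r * y₂ := by rw [hX]; ring
    rw [e1, e2]; ring
  linarith

/-- If `φ` carries mass at most `ε²` on `L`, then the quadratic form of the rank-one term is, up to
`O(ε)`, block diagonal with respect to `L` and its complement. -/
theorem dotProduct_sq_le_of_small_mass {φ x : n → ℝ} {ε : ℝ} (hε : 0 < ε) (L : Finset n)
    (hL : ∑ i ∈ L, φ i ^ 2 ≤ ε ^ 2) :
    (φ ⬝ᵥ x) ^ 2 ≤
      (1 + ε) * (∑ i ∈ Lᶜ, φ i * x i) ^ 2 + (ε + ε ^ 2) * ∑ i ∈ L, x i ^ 2 := by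
  have h1 : φ ⬝ᵥ x = ∑ i ∈ L, φ i * x i + ∑ i ∈ Lᶜ, φ i * x i :=
    (Finset.sum_add_sum_compl L _).symm
  set p := ∑ i ∈ L, φ i * x i
  set r := ∑ i ∈ Lᶜ, φ i * x i
  have hs : 0 ≤ ∑ i ∈ L, x i ^ 2 := Finset.sum_nonneg fun i _ => sq_nonneg _
  have h2 : p ^ 2 ≤ ε ^ 2 * ∑ i ∈ L, x i ^ 2 :=
    (Finset.sum_mul_sq_le_sq_mul_sq L φ x).trans (mul_le_mul_of_nonneg_right hL hs)
  rw [h1]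
  have h3 : (p + r) ^ 2 ≤ (1 + ε) * r ^ 2 + (1 + 1 / ε) * p ^ 2 := by
    have : 0 ≤ (ε * r - p) ^ 2 / ε := by positivity
    have e : (ε * r - p) ^ 2 / ε = (1 + ε) * r ^ 2 + (1 + 1 / ε) * p ^ 2 - (p + r) ^ 2 := by
      field_simp
      ring
    linarith
  have h4 : (1 + 1 / ε) * p ^ 2 ≤ (1 + 1 / ε) * (ε ^ 2 * ∑ i ∈ L, x i ^ 2) :=
    mul_le_mul_of_nonneg_left h2 (by positivity)
  have h5 : (1 + 1 / ε) * (ε ^ 2 * ∑ i ∈ L, x i ^ 2) = (ε + ε ^ 2) * ∑ i ∈ L, x i ^ 2 := by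
    field_simp
    ring
  linarith

/-- Upper bound for the trace: outside of a set `L` of small `φ`-mass, `g` is replaced by the
constant `b`; what is left is block diagonal up to small errors, and on the complement of `L` it
is a multiple of the identity plus a rank-one matrix. -/
theorem trace_exp_rankOnePerturbation_le {a b ε : ℝ} {φ g : n → ℝ} (ha : 0 ≤ a) (hb : 0 ≤ b)
    (hε : 0 < ε) (hφ : ∑ i, φ i ^ 2 ≤ 1) (L : Finset n) (hL : ∑ i ∈ L, φ i ^ 2 ≤ ε ^ 2)
    (hg : ∀ i ∉ L, g i ≤ b) :
    (NormedSpace.exp (rankOnePerturbation a φ g)).trace ≤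
      Real.exp (-a + a * (ε + ε ^ 2) + b) *
        (∑ i, Real.exp (g i) + Real.exp a + Fintype.card n) := by
  obtain ⟨v, hv1, hv2, hv3⟩ := exists_trace_exp_eq (isHermitian_rankOnePerturbation a φ g)
  rw [hv3]
  set C := Real.exp (-a + a * (ε + ε ^ 2) + b) with hC
  have hCpos : 0 < C := Real.exp_pos _
  have hφL : ∑ j ∈ Lᶜ, φ j ^ 2 ≤ 1 :=
    (Finset.sum_le_sum_of_subset_of_nonneg (Finset.subset_univ _)
      fun _ _ _ => sq_nonneg _).trans hφ
  have key : ∀ i, Real.exp (v i ⬝ᵥ (rankOnePerturbation a φ g).mulVec (v i)) ≤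
      C * (∑ j ∈ L, v i j ^ 2 * Real.exp (g j) +
        (∑ j ∈ Lᶜ, φ j * v i j) ^ 2 * Real.exp a + ∑ j ∈ Lᶜ, v i j ^ 2) := by
    intro i
    have hone : ∑ j ∈ L, v i j ^ 2 + ∑ j ∈ Lᶜ, v i j ^ 2 = 1 := by
      rw [Finset.sum_add_sum_compl, ← hv1 i]
      exact Finset.sum_congr rfl fun j _ => by ring
    rw [dotProduct_rankOnePerturbation_mulVec, hv1 i]
    have hsq := dotProduct_sq_le_of_small_mass (x := v i) hε L hL
    have hqs : (∑ j ∈ Lᶜ, φ j * v i j) ^ 2 ≤ ∑ j ∈ Lᶜ, v i j ^ 2 :=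
      (Finset.sum_mul_sq_le_sq_mul_sq _ _ _).trans
        (mul_le_of_le_one_left (Finset.sum_nonneg fun _ _ => sq_nonneg _) hφL)
    have hgs : ∑ j, g j * v i j ^ 2 ≤ ∑ j ∈ L, g j * v i j ^ 2 + b * ∑ j ∈ Lᶜ, v i j ^ 2 := by
      rw [← Finset.sum_add_sum_compl L, Finset.mul_sum]
      gcongr with j hj
      exact hg j (Finset.mem_compl.1 hj)
    set q := (∑ j ∈ Lᶜ, φ j * v i j) ^ 2
    set s := ∑ j ∈ Lᶜ, v i j ^ 2
    set l := ∑ j ∈ L, v i j ^ 2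
    have hq0 : 0 ≤ q := sq_nonneg _
    have hs0 : 0 ≤ s := hq0.trans hqs
    have hexp := exp_sum_add_add_le L (fun j => v i j ^ 2)
      (fun j => g j + (-a + a * (ε + ε ^ 2))) (q := q) (r := s - q) (y₁ := a * ε + b)
      (y₂ := b - a) (fun _ _ => sq_nonneg _) hq0 (by linarith) (by linarith)
    have hsum : ∑ j ∈ L, v i j ^ 2 * (g j + (-a + a * (ε + ε ^ 2))) =
        ∑ j ∈ L, g j * v i j ^ 2 + l * (-a + a * (ε + ε ^ 2)) := by
      rw [Finset.sum_mul, ← Finset.sum_add_distrib]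
      exact Finset.sum_congr rfl fun j _ => by ring
    rw [hsum] at hexp
    have hl : l = 1 - s := by linarith
    have hsq' := mul_le_mul_of_nonneg_left hsq ha
    have haε : 0 ≤ a * ε := by positivity
    have haε2 : 0 ≤ a * ε ^ 2 := by positivity
    refine (Real.exp_le_exp.2 ?_).trans (hexp.trans ?_)
    · rw [hl] at hsq' ⊢
      linarith
    · rw [mul_add C, mul_add C, Finset.mul_sum]
      refine add_le_add (add_le_add ?_ ?_) ?_
      · refine Finset.sum_le_sum fun j _ => ?_
        rw [mul_left_comm]
        refine mul_le_mul_of_nonneg_left ?_ (sq_nonneg _)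
        rw [hC, ← Real.exp_add]
        exact Real.exp_le_exp.2 (by linarith)
      · rw [mul_left_comm]
        refine mul_le_mul_of_nonneg_left ?_ hq0
        rw [hC, ← Real.exp_add]
        exact Real.exp_le_exp.2 (by linarith)
      · rw [mul_comm]
        refine mul_le_mul (Real.exp_le_exp.2 (by linarith)) (by linarith) (by linarith) hCpos.le
  have hcoord : ∀ j, ∑ i, v i j ^ 2 = 1 := by
    intro j
    have := hv2 (Pi.single j 1)
    simpa using this
  refine (Finset.sum_le_sum fun i _ => key i).trans ?_
  rw [← Finset.mul_sum]
  refine mul_le_mul_of_nonneg_left ?_ hCpos.le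
  rw [Finset.sum_add_distrib, Finset.sum_add_distrib]
  refine add_le_add (add_le_add ?_ ?_) ?_
  · rw [Finset.sum_comm]
    simp only [← Finset.sum_mul, hcoord, one_mul]
    exact Finset.sum_le_sum_of_subset_of_nonneg (Finset.subset_univ _)
      fun _ _ _ => (Real.exp_pos _).le
  · rw [← Finset.sum_mul]
    refine mul_le_of_le_one_left (Real.exp_pos _).le ?_
    have := hv2 (fun j => if j ∈ Lᶜ then φ j else 0)
    simp only [dotProduct, ite_mul, zero_mul, mul_ite, mul_zero] at this
    simp only [Finset.sum_ite_mem, Finset.univ_inter, ← ite_and, and_self] at this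
    rw [this]
    simpa only [← sq, Finset.sum_ite_mem, Finset.univ_inter] using hφL
  · rw [Finset.sum_comm]
    simp only [hcoord, Finset.sum_const, nsmul_eq_mul, mul_one]
    exact_mod_cast Finset.card_le_univ _

end Matrix

/-! ### The partition function of the random energy model -/

section REM

variable {Ω : Type*} [MeasurableSpace Ω] {P : Measure Ω}

/-- A Borel–Cantelli lemma for exponentially small probabilities. -/
theorem ae_eventually_notMem_of_le_exp {s : ℕ → Set Ω} {C c : ℝ} (hc : 0 < c)
    (h : ∀ᶠ N : ℕ in atTop, P (s N) ≤ ENNReal.ofReal (C * Real.exp (-(c * N)))) :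
    ∀ᵐ ω ∂P, ∀ᶠ N in atTop, ω ∉ s N := by
  obtain ⟨N₀, hN₀⟩ := eventually_atTop.1 h
  have hsum : Summable fun N : ℕ => |C| * Real.exp (-(c * (N + N₀ : ℕ))) := by
    have h1 : Summable fun N : ℕ => Real.exp (-(c * N)) := by
      have := Real.summable_exp_nat_mul_iff.2 (neg_lt_zero.2 hc)
      refine this.congr fun N => ?_
      congr 1
      ring
    exact ((summable_nat_add_iff N₀).2 h1).mul_left _
  have hfin : ∑' N, P (s (N + N₀)) ≠ ⊤ := by
    refine ne_top_of_le_ne_top hsum.tsum_ofReal_ne_top (ENNReal.tsum_le_tsum fun N => ?_)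
    refine (hN₀ (N + N₀) (by omega)).trans (ENNReal.ofReal_le_ofReal ?_)
    exact mul_le_mul_of_nonneg_right (le_abs_self C) (Real.exp_pos _).le
  filter_upwards [ae_eventually_notMem hfin] with ω hω
  obtain ⟨M, hM⟩ := eventually_atTop.1 hω
  refine eventually_atTop.2 ⟨M + N₀, fun N hN => ?_⟩
  have := hM (N - N₀) (by omega)
  rwa [Nat.sub_add_cancel (by omega)] at this

/-- The normalised partition function `2^{-N} ∑ exp(-β u(σ))` of an energy function `u`. -/
noncomputable def partitionFunction (N : ℕ) (β : ℝ) (u : Config N → ℝ) : ℝ :=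
  ((2 : ℝ) ^ N)⁻¹ * ∑ σ, Real.exp (-β * u σ)

theorem card_config (N : ℕ) : Fintype.card (Config N) = 2 ^ N := by
  simp [Config]

theorem two_pow_eq_exp (N : ℕ) : (2 : ℝ) ^ N = Real.exp (N * Real.log 2) := by
  rw [mul_comm, Real.exp_mul, Real.exp_log (by norm_num), Real.rpow_natCast]

theorem partitionFunction_pos (N : ℕ) (β : ℝ) (u : Config N → ℝ) :
    0 < partitionFunction N β u :=
  mul_pos (by positivity) (Finset.sum_pos (fun _ _ => Real.exp_pos _) Finset.univ_nonempty)

variable {U : (N : ℕ) → Config N → Ω → ℝ}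

theorem IsREM.integrable_exp (hU : IsREM P U) (N : ℕ) (σ : Config N) (t : ℝ) :
    Integrable (fun ω => Real.exp (t * U N σ ω)) P := by
  have h := integrable_exp_mul_gaussianReal (μ := 0) (v := (N : ℝ≥0)) t
  rw [← (hU.hasLaw N σ).map_eq] at h
  exact h.comp_aemeasurable (hU.hasLaw N σ).aemeasurable

theorem IsREM.integral_exp (hU : IsREM P U) (N : ℕ) (σ : Config N) (t : ℝ) :
    ∫ ω, Real.exp (t * U N σ ω) ∂P = Real.exp (N * (t ^ 2 / 2)) := by
  have h := mgf_gaussianReal (hU.hasLaw N σ).map_eq t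
  rw [mgf] at h
  rw [h]
  congr 1
  simp
  ring

theorem IsREM.integrable_partitionFunction (hU : IsREM P U) (N : ℕ) (β : ℝ) :
    Integrable (fun ω => partitionFunction N β (fun σ => U N σ ω)) P :=
  (integrable_finsetSum _ fun σ _ => hU.integrable_exp N σ (-β)).const_mul _

theorem IsREM.integral_partitionFunction (hU : IsREM P U) (N : ℕ) (β : ℝ) :
    ∫ ω, partitionFunction N β (fun σ => U N σ ω) ∂P = Real.exp (N * (β ^ 2 / 2)) := by
  simp only [partitionFunction]
  rw [integral_const_mul, integral_finsetSum _ fun σ _ => hU.integrable_exp N σ (-β)]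
  simp only [hU.integral_exp, Finset.sum_const, Finset.card_univ, card_config, nsmul_eq_mul]
  push_cast
  rw [neg_sq, inv_mul_cancel_left₀ (by positivity)]

/-- The annealed upper bound, valid at every (also at negative) inverse temperature. -/
theorem IsREM.ae_eventually_partitionFunction_le [IsFiniteMeasure P] (hU : IsREM P U) (β : ℝ)
    {ε : ℝ} (hε : 0 < ε) :
    ∀ᵐ ω ∂P, ∀ᶠ N : ℕ in atTop,
      partitionFunction N β (fun σ => U N σ ω) ≤ Real.exp (N * (β ^ 2 / 2 + ε)) := by
  have h := ae_eventually_notMem_of_le_exp (P := P) (C := 1) hε (s := fun N : ℕ =>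
    {ω | Real.exp (N * (β ^ 2 / 2 + ε)) ≤ partitionFunction N β (fun σ => U N σ ω)})
    (Eventually.of_forall fun N => by
      have h1 := mul_meas_ge_le_integral_of_nonneg
        (Eventually.of_forall fun ω => (partitionFunction_pos N β fun σ => U N σ ω).le)
        (hU.integrable_partitionFunction N β) (Real.exp (N * (β ^ 2 / 2 + ε)))
      rw [hU.integral_partitionFunction, ← le_div_iff₀' (Real.exp_pos _), ← Real.exp_sub] at h1
      rw [← ofReal_measureReal]
      refine ENNReal.ofReal_le_ofReal (h1.trans (le_of_eq ?_))
      rw [one_mul]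
      congr 1
      ring)
  filter_upwards [h] with ω hω
  filter_upwards [hω] with N hN
  exact (not_le.1 hN).le

theorem betaC_pos : 0 < betaC := Real.sqrt_pos.2 (by have := Real.log_pos one_lt_two; linarith)

theorem betaC_sq : betaC ^ 2 = 2 * Real.log 2 :=
  Real.sq_sqrt (by have := Real.log_pos one_lt_two; linarith)

/-- Superadditivity: `∑ exp(-β u) ≤ (∑ exp(-β₀ u))^{β / β₀}` for `β ≥ β₀ > 0`. -/
theorem partitionFunction_le_of_le {N : ℕ} {β₀ β s : ℝ} (hβ₀ : 0 < β₀) (hβ : β₀ ≤ β)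
    {u : Config N → ℝ} (h : partitionFunction N β₀ u ≤ Real.exp s) :
    partitionFunction N β u ≤
      Real.exp ((s + N * Real.log 2) * (β / β₀) - N * Real.log 2) := by
  have h2 : (0 : ℝ) < 2 ^ N := by positivity
  have hsum : ∑ σ, Real.exp (-β₀ * u σ) ≤ Real.exp (s + N * Real.log 2) := by
    rw [Real.exp_add, ← two_pow_eq_exp]
    rw [partitionFunction, inv_mul_le_iff₀ h2] at h
    linarith
  set t := s + N * Real.log 2
  have hu : ∀ σ, -β₀ * u σ ≤ t := fun σ => Real.exp_le_exp.1 <|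
    (Finset.single_le_sum (f := fun σ => Real.exp (-β₀ * u σ)) (fun _ _ => (Real.exp_pos _).le)
      (Finset.mem_univ σ)).trans hsum
  have hterm : ∀ σ, Real.exp (-β * u σ) ≤
      Real.exp (-β₀ * u σ) * Real.exp (t * (β / β₀ - 1)) := by
    intro σ
    rw [← Real.exp_add]
    refine Real.exp_le_exp.2 ?_
    have h3 : 0 ≤ β / β₀ - 1 := by
      rw [sub_nonneg, le_div_iff₀ hβ₀]; linarith
    have h4 := mul_le_mul_of_nonneg_right (hu σ) h3
    have h5 : -β₀ * u σ * (β / β₀ - 1) = -β * u σ + β₀ * u σ := by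
      field_simp
      ring
    linarith
  rw [partitionFunction, inv_mul_le_iff₀ h2]
  calc ∑ σ, Real.exp (-β * u σ)
      ≤ (∑ σ, Real.exp (-β₀ * u σ)) * Real.exp (t * (β / β₀ - 1)) := by
        rw [Finset.sum_mul]; exact Finset.sum_le_sum fun σ _ => hterm σ
    _ ≤ Real.exp t * Real.exp (t * (β / β₀ - 1)) :=
        mul_le_mul_of_nonneg_right hsum (Real.exp_pos _).le
    _ = 2 ^ N * Real.exp (t * (β / β₀) - N * Real.log 2) := by
        rw [two_pow_eq_exp, ← Real.exp_add, ← Real.exp_add]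
        congr 1
        ring

theorem IsREM.ae_eventually_partitionFunction_le_pressure [IsFiniteMeasure P] (hU : IsREM P U)
    (β : ℝ) {ε : ℝ} (hε : 0 < ε) :
    ∀ᵐ ω ∂P, ∀ᶠ N : ℕ in atTop,
      partitionFunction N β (fun σ => U N σ ω) ≤ Real.exp (N * (pressure β + ε)) := by
  by_cases hβ : β ≤ betaC
  · simp only [pressure, if_pos hβ]
    exact hU.ae_eventually_partitionFunction_le β hε
  · simp only [pressure, if_neg hβ]
    rw [not_le] at hβ
    have hβpos := betaC_pos.trans hβ
    have hδ : 0 < ε * betaC / β := div_pos (mul_pos hε betaC_pos) hβpos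
    filter_upwards [hU.ae_eventually_partitionFunction_le betaC hδ] with ω hω
    filter_upwards [hω] with N hN
    refine (partitionFunction_le_of_le betaC_pos hβ.le hN).trans (Real.exp_le_exp.2 (le_of_eq ?_))
    have hb := betaC_pos.ne'
    have h1 : Real.log 2 = betaC ^ 2 / 2 := by rw [betaC_sq]; ring
    rw [h1]
    field_simp
    ring

/-- A lower bound for the Gaussian tail on the scale of large deviations. -/
theorem eventually_exp_le_gaussianReal_Iic {a ε : ℝ} (ha : 0 ≤ a) (hε : 0 < ε) :
    ∀ᶠ N : ℕ in atTop, Real.exp (-(N * (a ^ 2 / 2 + ε))) ≤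
      (gaussianReal 0 (N : ℝ≥0)).real (Set.Iic (-(a * N))) := by
  have hlim : Tendsto (fun N : ℕ => (N : ℝ) ^ 1 * Real.exp (-(2 * ε * N))) atTop (𝓝 0) := by
    have h1 := (Real.tendsto_pow_mul_exp_neg_atTop_nhds_zero 1).comp
      ((tendsto_natCast_atTop_atTop (R := ℝ)).const_mul_atTop (show 0 < 2 * ε by linarith))
    have h2 := h1.const_mul (2 * ε)⁻¹
    rw [mul_zero] at h2
    refine h2.congr fun N => ?_
    simp only [Function.comp]
    field_simp
  have hK : 0 < (2 * Real.pi * Real.exp (2 * a + 1))⁻¹ := by positivity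
  filter_upwards [hlim.eventually (gt_mem_nhds hK), eventually_ge_atTop 1] with N hN hN1
  have hNpos : (0 : ℝ) < N := by exact_mod_cast hN1
  have hN1' : (1 : ℝ) ≤ N := by exact_mod_cast hN1
  have hv : (N : ℝ≥0) ≠ 0 := by exact_mod_cast hNpos.ne'
  set I := Set.Icc (-(a * N + 1)) (-(a * N))
  set m := (Real.sqrt (2 * Real.pi * N))⁻¹ * Real.exp (-(a * N + 1) ^ 2 / (2 * N)) with hm
  have hpdf : ∀ x ∈ I, ENNReal.ofReal m ≤ gaussianPDF 0 (N : ℝ≥0) x := by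
    intro x hx
    refine ENNReal.ofReal_le_ofReal ?_
    rw [gaussianPDFReal]
    simp only [NNReal.coe_natCast, sub_zero]
    refine mul_le_mul_of_nonneg_left (Real.exp_le_exp.2 ?_) (by positivity)
    refine div_le_div_of_nonneg_right (neg_le_neg ?_) (by positivity)
    have h0 : 0 ≤ a * N := by positivity
    nlinarith [hx.1, hx.2]
  have h1 : ENNReal.ofReal m ≤ gaussianReal 0 (N : ℝ≥0) (Set.Iic (-(a * N))) := by
    calc ENNReal.ofReal m = ∫⁻ _ in I, ENNReal.ofReal m := by
          rw [setLIntegral_const, Real.volume_Icc]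
          simp
      _ ≤ ∫⁻ x in I, gaussianPDF 0 (N : ℝ≥0) x := setLIntegral_mono' measurableSet_Icc hpdf
      _ = gaussianReal 0 (N : ℝ≥0) I := (gaussianReal_apply 0 hv I).symm
      _ ≤ _ := measure_mono Set.Icc_subset_Iic_self
  have h2 : m ≤ (gaussianReal 0 (N : ℝ≥0)).real (Set.Iic (-(a * N))) :=
    (ENNReal.ofReal_le_iff_le_toReal (measure_ne_top _ _)).1 h1
  refine le_trans ?_ h2
  -- it remains to absorb the prefactor into `exp(N ε)`
  have h3 : Real.sqrt (2 * Real.pi * N) ≤ Real.exp (ε * N - (a + 1 / 2)) := by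
    refine Real.sqrt_le_iff.2 ⟨(Real.exp_pos _).le, ?_⟩
    rw [pow_one, ← one_div, lt_div_iff₀ (by positivity)] at hN
    have e1 : Real.exp (-(2 * ε * N)) * Real.exp (2 * a + 1) *
        Real.exp (ε * N - (a + 1 / 2)) ^ 2 = 1 := by
      rw [← Real.exp_nat_mul, ← Real.exp_add, ← Real.exp_add, Real.exp_eq_one_iff]
      push_cast
      ring
    have e2 := mul_lt_mul_of_pos_right hN
      (show 0 < Real.exp (ε * N - (a + 1 / 2)) ^ 2 by positivity)
    have e3 : (N : ℝ) * Real.exp (-(2 * ε * N)) * (2 * Real.pi * Real.exp (2 * a + 1)) *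
        Real.exp (ε * N - (a + 1 / 2)) ^ 2 = 2 * Real.pi * N *
        (Real.exp (-(2 * ε * N)) * Real.exp (2 * a + 1) *
        Real.exp (ε * N - (a + 1 / 2)) ^ 2) := by ring
    rw [e3, e1] at e2
    linarith
  have hs : 0 < Real.sqrt (2 * Real.pi * N) := Real.sqrt_pos.2 (by positivity)
  rw [hm, inv_mul_eq_div, le_div_iff₀ hs]
  refine (mul_le_mul_of_nonneg_left h3 (Real.exp_pos _).le).trans ?_
  rw [← Real.exp_add]
  refine Real.exp_le_exp.2 ?_
  have h4 : -(a * N + 1) ^ 2 / (2 * N) = -(N * (a ^ 2 / 2)) - a - 1 / (2 * N) := by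
    field_simp
    ring
  have h5 : 1 / (2 * (N : ℝ)) ≤ 1 / 2 := by
    refine one_div_le_one_div_of_le (by norm_num) (by linarith)
  rw [h4]
  linarith

end REM

/-! ### Second moment lower bound for the partition function -/

section Lower

variable {Ω : Type*} [MeasurableSpace Ω] {P : Measure Ω}
variable {U : (N : ℕ) → Config N → Ω → ℝ}

/-- The indicator function of the energies below `-a N`. -/
noncomputable def levelIndicator (N : ℕ) (a : ℝ) : ℝ → ℝ :=
  (Set.Iic (-(a * N))).indicator 1

theorem measurable_levelIndicator (N : ℕ) (a : ℝ) : Measurable (levelIndicator N a) :=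
  measurable_one.indicator measurableSet_Iic

/-- Chebyshev's inequality for the number of configurations with energy below `-a N`: the
probability that it is at most half of its mean is at most four divided by its mean. -/
theorem IsREM.measure_sum_levelIndicator_le [IsProbabilityMeasure P] (hU : IsREM P U) (N : ℕ)
    (a : ℝ) {p : ℝ} (hp : (gaussianReal 0 (N : ℝ≥0)).real (Set.Iic (-(a * N))) = p)
    (hp0 : 0 < p) :
    P {ω | ∑ σ, levelIndicator N a (U N σ ω) ≤ 2 ^ N * p / 2} ≤
      ENNReal.ofReal (4 / (2 ^ N * p)) := by
  set X : Config N → Ω → ℝ := fun σ => levelIndicator N a ∘ U N σ with hX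
  have hmeas : ∀ σ, AEStronglyMeasurable (X σ) P := fun σ =>
    ((measurable_levelIndicator N a).comp_aemeasurable
      (hU.hasLaw N σ).aemeasurable).aestronglyMeasurable
  have hLp : ∀ σ, MemLp (X σ) 2 P := fun σ => by
    refine MemLp.of_bound (hmeas σ) 1 (Eventually.of_forall fun ω => ?_)
    simp only [hX, Function.comp, levelIndicator, Set.indicator_apply]
    split_ifs <;> simp
  have hmean : ∀ σ, ∫ ω, X σ ω ∂P = p := fun σ => by
    rw [(hU.hasLaw N σ).integral_comp (measurable_levelIndicator N a).aestronglyMeasurable,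
      levelIndicator, integral_indicator_one measurableSet_Iic, hp]
  have hvar : ∀ σ, variance (X σ) P ≤ p := fun σ => by
    refine (variance_le_expectation_sq (hmeas σ)).trans (le_of_eq ?_)
    rw [← hmean σ]
    refine integral_congr_ae (Eventually.of_forall fun ω => ?_)
    simp only [hX, Function.comp, levelIndicator, Set.indicator_apply, Pi.pow_apply]
    split_ifs <;> simp
  have hindep : iIndepFun X P :=
    (hU.indep N).comp (fun _ => levelIndicator N a) fun _ => measurable_levelIndicator N a
  have hVar : variance (∑ σ, X σ) P ≤ 2 ^ N * p := by
    rw [IndepFun.variance_sum (fun σ _ => hLp σ) fun σ _ τ _ hne => hindep.indepFun hne]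
    refine (Finset.sum_le_sum fun σ _ => hvar σ).trans (le_of_eq ?_)
    rw [Finset.sum_const, Finset.card_univ, card_config, nsmul_eq_mul]
    push_cast
    rfl
  have hE : ∫ ω, (∑ σ, X σ) ω ∂P = 2 ^ N * p := by
    simp only [Finset.sum_apply]
    rw [integral_finsetSum _ fun σ _ => (hLp σ).integrable one_le_two]
    simp only [hmean]
    rw [Finset.sum_const, Finset.card_univ, card_config, nsmul_eq_mul]
    push_cast
    rfl
  have h0 : 0 < 2 ^ N * p := by positivity
  have hcheb := meas_ge_le_variance_div_sq (memLp_finsetSum' Finset.univ fun σ _ => hLp σ)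
    (half_pos h0)
  rw [hE] at hcheb
  refine (measure_mono fun ω hω => ?_).trans (hcheb.trans (ENNReal.ofReal_le_ofReal ?_))
  · simp only [Set.mem_ofPred_eq] at hω ⊢
    rw [Finset.sum_apply]
    refine le_trans ?_ (neg_le_abs _)
    simp only [hX, Function.comp]
    linarith
  · refine (div_le_div_of_nonneg_right hVar (by positivity)).trans (le_of_eq ?_)
    field_simp
    norm_num

theorem partitionFunction_ge_sum_levelIndicator {N : ℕ} {β : ℝ} (hβ : 0 ≤ β) (a : ℝ)
    (u : Config N → ℝ) :
    ((2 : ℝ) ^ N)⁻¹ * (Real.exp (β * a * N) * ∑ σ, levelIndicator N a (u σ)) ≤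
      partitionFunction N β u := by
  rw [partitionFunction, Finset.mul_sum]
  gcongr with σ
  simp only [levelIndicator, Set.indicator_apply, Set.mem_Iic, Pi.one_apply]
  split_ifs with h
  · rw [mul_one]
    refine Real.exp_le_exp.2 ?_
    have := mul_le_mul_of_nonneg_left h hβ
    linarith
  · rw [mul_zero]
    exact (Real.exp_pos _).le

/-- For `a < β_c` the level `-a N` is populated by exponentially many configurations, whose number
is at least half of its mean by the second moment; they contribute `β a - a² / 2` to the rate. -/
theorem IsREM.ae_eventually_le_partitionFunction_of_lt [IsProbabilityMeasure P] (hU : IsREM P U)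
    {a β ε : ℝ} (hβ : 0 ≤ β) (ha : 0 ≤ a) (hac : a < betaC) (hε : 0 < ε) :
    ∀ᵐ ω ∂P, ∀ᶠ N : ℕ in atTop,
      Real.exp (N * (β * a - a ^ 2 / 2 - ε)) ≤ partitionFunction N β (fun σ => U N σ ω) := by
  have hgap : 0 < Real.log 2 - a ^ 2 / 2 := by
    have h1 := betaC_sq
    have h2 : a ^ 2 < betaC ^ 2 := by gcongr
    linarith
  set c := (Real.log 2 - a ^ 2 / 2) / 2 with hc
  have hc0 : 0 < c := half_pos hgap
  set p : ℕ → ℝ := fun N => (gaussianReal 0 (N : ℝ≥0)).real (Set.Iic (-(a * N))) with hp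
  have h := ae_eventually_notMem_of_le_exp (P := P) (C := 4) hc0 (s := fun N : ℕ =>
    {ω | ∑ σ, levelIndicator N a (U N σ ω) ≤ 2 ^ N * p N / 2}) (by
      filter_upwards [eventually_exp_le_gaussianReal_Iic ha hc0] with N hN
      have hp0 : 0 < p N := (Real.exp_pos _).trans_le hN
      refine (hU.measure_sum_levelIndicator_le N a rfl hp0).trans (ENNReal.ofReal_le_ofReal ?_)
      rw [Real.exp_neg, ← div_eq_mul_inv]
      refine div_le_div_of_nonneg_left (by norm_num) (Real.exp_pos _) ?_
      refine le_trans (le_of_eq ?_) (mul_le_mul_of_nonneg_left hN (by positivity))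
      rw [two_pow_eq_exp, ← Real.exp_add]
      congr 1
      rw [hc]
      ring)
  have hlarge : ∀ᶠ N : ℕ in atTop, Real.log 2 ≤ ε / 2 * N :=
    ((tendsto_natCast_atTop_atTop (R := ℝ)).const_mul_atTop (half_pos hε)).eventually_ge_atTop _
  filter_upwards [h] with ω hω
  filter_upwards [hω, eventually_exp_le_gaussianReal_Iic ha (half_pos hε), hlarge]
    with N hN hpN hlN
  refine le_trans ?_ (partitionFunction_ge_sum_levelIndicator hβ a _)
  have h1 : 2 ^ N * p N / 2 ≤ ∑ σ, levelIndicator N a (U N σ ω) := (not_le.1 hN).le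
  have h2 : Real.exp (-Real.log 2) = 1 / 2 := by
    rw [Real.exp_neg, Real.exp_log (by norm_num), one_div]
  calc Real.exp (N * (β * a - a ^ 2 / 2 - ε))
      ≤ Real.exp (β * a * N + (-(N * (a ^ 2 / 2 + ε / 2)) + -Real.log 2)) :=
        Real.exp_le_exp.2 (by linarith)
    _ = Real.exp (β * a * N) * (Real.exp (-(N * (a ^ 2 / 2 + ε / 2))) * (1 / 2)) := by
        rw [Real.exp_add, Real.exp_add, h2]
    _ ≤ Real.exp (β * a * N) * (p N * (1 / 2)) := by gcongr
    _ = ((2 : ℝ) ^ N)⁻¹ * (Real.exp (β * a * N) * (2 ^ N * p N / 2)) := by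
        field_simp
    _ ≤ _ := by gcongr

theorem IsREM.ae_eventually_pressure_le_partitionFunction [IsProbabilityMeasure P]
    (hU : IsREM P U) {β ε : ℝ} (hβ : 0 ≤ β) (hε : 0 < ε) :
    ∀ᵐ ω ∂P, ∀ᶠ N : ℕ in atTop,
      Real.exp (N * (pressure β - ε)) ≤ partitionFunction N β (fun σ => U N σ ω) := by
  -- the pressure is the supremum of `β a - a² / 2` over the levels `a ∈ [0, β_c)`
  obtain ⟨a, ha, hac, hpa⟩ : ∃ a, 0 ≤ a ∧ a < betaC ∧ pressure β - ε / 2 ≤ β * a - a ^ 2 / 2 := by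
    rcases lt_or_ge β betaC with h | h
    · refine ⟨β, hβ, h, ?_⟩
      rw [pressure, if_pos h.le]
      nlinarith
    · have hpr : pressure β = β * betaC - betaC ^ 2 / 2 := by
        rw [pressure]
        split_ifs with h'
        · rw [le_antisymm h' h]; ring
        · rw [betaC_sq]; ring
      have hcont : Tendsto (fun a : ℝ => β * a - a ^ 2 / 2) (𝓝[<] betaC)
          (𝓝 (β * betaC - betaC ^ 2 / 2)) :=
        (Continuous.tendsto (by fun_prop) betaC).mono_left nhdsWithin_le_nhds
      have h1 := hcont.eventually (lt_mem_nhds (show pressure β - ε / 2 < _ by rw [hpr]; linarith))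
      have h2 : ∀ᶠ a in 𝓝[<] betaC, 0 < a :=
        nhdsWithin_le_nhds (lt_mem_nhds betaC_pos)
      obtain ⟨a, ⟨h1, h2⟩, h3⟩ := ((h1.and h2).and self_mem_nhdsWithin).exists
      exact ⟨a, h2.le, h3, h1.le⟩
  filter_upwards [hU.ae_eventually_le_partitionFunction_of_lt hβ ha hac (half_pos hε)] with ω hω
  filter_upwards [hω] with N hN
  refine (Real.exp_le_exp.2 ?_).trans hN
  exact mul_le_mul_of_nonneg_left (by linarith) (Nat.cast_nonneg N)

end Lower

/-! ### The quantum partition function -/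

section Quantum

theorem flatState_sq (N : ℕ) (σ : Config N) : flatState N σ ^ 2 = ((2 : ℝ) ^ N)⁻¹ := by
  rw [flatState, ← Real.rpow_natCast, ← Real.rpow_mul (by norm_num), ← Real.rpow_natCast,
    ← Real.rpow_neg (by norm_num)]
  congr 1
  push_cast
  ring

theorem sum_flatState_sq (N : ℕ) : ∑ σ, flatState N σ ^ 2 = 1 := by
  simp only [flatState_sq, Finset.sum_const, Finset.card_univ, card_config, nsmul_eq_mul]
  push_cast
  exact mul_inv_cancel₀ (by positivity)

theorem smul_tiltedGenerator (N : ℕ) (T lam : ℝ) (u : Config N → ℝ) :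
    T⁻¹ • tiltedGenerator N lam u =
      rankOnePerturbation (N / T) (flatState N) (fun σ => -(lam / T) * u σ) := by
  rw [tiltedGenerator, generator_eq, rankOnePerturbation]
  ext σ τ
  by_cases h : σ = τ
  · subst h
    simp
    ring
  · simp [h]
    ring

/-- The normalised quantum partition function `2^{-N} Tr exp((W - λ u) / T)`. -/
noncomputable def quantumPartitionFunction (N : ℕ) (T lam : ℝ) (u : Config N → ℝ) : ℝ :=
  ((2 : ℝ) ^ N)⁻¹ * (NormedSpace.exp (T⁻¹ • tiltedGenerator N lam u)).trace

/-- Peierls inequality in the canonical basis: the classical lower bound. -/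
theorem exp_mul_partitionFunction_le_quantumPartitionFunction {N : ℕ} {T : ℝ} (hT : 0 < T)
    (lam : ℝ) (u : Config N → ℝ) :
    Real.exp (-(N / T)) * partitionFunction N (lam / T) u ≤ quantumPartitionFunction N T lam u := by
  rw [quantumPartitionFunction, partitionFunction, smul_tiltedGenerator, mul_left_comm]
  gcongr
  refine le_trans ?_ (sum_exp_diag_le_trace (isHermitian_rankOnePerturbation _ _ _))
  rw [Finset.mul_sum]
  refine Finset.sum_le_sum fun σ _ => ?_
  rw [← Real.exp_add]
  refine Real.exp_le_exp.2 ?_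
  have h : 0 ≤ N / T * flatState N σ ^ 2 := by positivity
  simp only [rankOnePerturbation, Matrix.add_apply, Matrix.smul_apply, Matrix.sub_apply,
    Matrix.vecMulVec_apply, Matrix.one_apply_eq, Matrix.diagonal_apply_eq, smul_eq_mul]
  linarith

/-- Peierls inequality in the flat state: the paramagnetic lower bound. -/
theorem exp_average_le_quantumPartitionFunction (N : ℕ) (T lam : ℝ) (u : Config N → ℝ) :
    ((2 : ℝ) ^ N)⁻¹ * Real.exp (-(lam / T) * (((2 : ℝ) ^ N)⁻¹ * ∑ σ, u σ)) ≤
      quantumPartitionFunction N T lam u := by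
  rw [quantumPartitionFunction, smul_tiltedGenerator]
  gcongr
  have hone : flatState N ⬝ᵥ flatState N = 1 := by
    rw [← sum_flatState_sq N]
    exact Finset.sum_congr rfl fun σ _ => by ring
  have h := exp_dotProduct_mulVec_le_trace (isHermitian_rankOnePerturbation (N / T) (flatState N)
    (fun σ => -(lam / T) * u σ)) hone
  rw [dotProduct_rankOnePerturbation_mulVec, hone] at h
  refine le_trans (le_of_eq ?_) h
  congr 1
  simp only [flatState_sq]
  rw [← Finset.sum_mul, ← Finset.mul_sum]
  ring

theorem average_le_of_partitionFunction_le {N : ℕ} {s t : ℝ} (hs : 0 < s) {u : Config N → ℝ}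
    (h : partitionFunction N (-s) u ≤ Real.exp (s * t)) : ((2 : ℝ) ^ N)⁻¹ * ∑ σ, u σ ≤ t := by
  have h1 := convexOn_exp.map_sum_le (t := (Finset.univ : Finset (Config N)))
    (w := fun _ => ((2 : ℝ) ^ N)⁻¹) (p := fun σ => s * u σ) (fun _ _ => by positivity)
    (by
      rw [Finset.sum_const, Finset.card_univ, card_config, nsmul_eq_mul]
      push_cast
      exact mul_inv_cancel₀ (by positivity))
    (fun _ _ => Set.mem_univ _)
  simp only [smul_eq_mul] at h1
  rw [← Finset.mul_sum, ← Finset.mul_sum, ← Finset.mul_sum] at h1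
  simp only [partitionFunction, neg_neg] at h
  have h2 := Real.exp_le_exp.1 (h1.trans h)
  rw [mul_left_comm] at h2
  exact le_of_mul_le_mul_left h2 hs

/-- The fraction of configurations with energy below `-x`, by Chebyshev's exponential bound. -/
theorem sum_flatState_sq_le {N : ℕ} {s : ℝ} (hs : 0 ≤ s) (x : ℝ) (u : Config N → ℝ) :
    ∑ σ with u σ < -x, flatState N σ ^ 2 ≤ Real.exp (-(s * x)) * partitionFunction N s u := by
  simp only [flatState_sq]
  rw [partitionFunction, Finset.mul_sum, Finset.mul_sum]
  refine (Finset.sum_le_sum fun σ hσ => ?_).trans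
    (Finset.sum_le_sum_of_subset_of_nonneg (Finset.filter_subset _ _) fun _ _ _ => by positivity)
  rw [mul_left_comm, ← Real.exp_add]
  refine le_mul_of_one_le_right (by positivity) (Real.one_le_exp ?_)
  have h := mul_le_mul_of_nonneg_left (Finset.mem_filter.1 hσ).2.le hs
  linarith

theorem quantumPartitionFunction_le {N : ℕ} {T lam ε : ℝ} (hT : 0 < T) (hlam : 0 ≤ lam)
    (hε : 0 < ε) (u : Config N → ℝ)
    (hL : ∑ σ with u σ < -(ε * N), flatState N σ ^ 2 ≤ ε ^ 2) :
    quantumPartitionFunction N T lam u ≤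
      Real.exp (-(N / T) + N / T * (ε + ε ^ 2) + lam / T * (ε * N)) *
        (partitionFunction N (lam / T) u + Real.exp (N / T - N * Real.log 2) + 1) := by
  rw [quantumPartitionFunction, smul_tiltedGenerator]
  have hβ : 0 ≤ lam / T := by positivity
  have h := trace_exp_rankOnePerturbation_le (a := N / T) (b := lam / T * (ε * N))
    (φ := flatState N) (g := fun σ => -(lam / T) * u σ) (by positivity) (by positivity) hε
    (sum_flatState_sq N).le _ hL (fun σ hσ => by
      have h1 : -(ε * N) ≤ u σ := by
        simpa only [Finset.mem_filter, Finset.mem_univ, true_and, not_lt] using hσ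
      have h2 := mul_le_mul_of_nonneg_left h1 hβ
      linarith)
  refine (mul_le_mul_of_nonneg_left h (by positivity)).trans (le_of_eq ?_)
  rw [mul_left_comm, card_config, mul_add, mul_add, partitionFunction, Real.exp_sub,
    ← two_pow_eq_exp]
  push_cast
  have h2 : (2 : ℝ) ^ N ≠ 0 := by positivity
  field_simp

end Quantum

/-! ### Almost sure limit of the free energy -/

section Limit

variable {Ω : Type*} [MeasurableSpace Ω] {P : Measure Ω}
variable {U : (N : ℕ) → Config N → Ω → ℝ}

theorem pressure_nonneg {β : ℝ} : 0 ≤ pressure β := by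
  rw [pressure]
  split_ifs with h
  · positivity
  · have h1 := betaC_sq
    have h2 := betaC_pos
    have h3 := Real.log_pos one_lt_two
    nlinarith

theorem IsREM.ae_eventually_le_quantumPartitionFunction [IsProbabilityMeasure P]
    (hU : IsREM P U) {T lam ε : ℝ} (hT : 0 < T) (hlam : 0 ≤ lam) (hε : 0 < ε) :
    ∀ᵐ ω ∂P, ∀ᶠ N : ℕ in atTop,
      Real.exp (N * (max (-Real.log 2) (pressure (lam / T) - 1 / T) - (1 + lam / T) * ε)) ≤
        quantumPartitionFunction N T lam (fun σ => U N σ ω) := by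
  have hβ : 0 ≤ lam / T := by positivity
  filter_upwards [hU.ae_eventually_pressure_le_partitionFunction hβ hε,
    hU.ae_eventually_partitionFunction_le (-ε) (show 0 < ε ^ 2 / 2 by positivity)] with ω h1 h2
  filter_upwards [h1, h2] with N h1 h2
  have hN : (0 : ℝ) ≤ N := N.cast_nonneg
  have hβε : 0 ≤ N * (lam / T * ε) := by positivity
  have hNε : 0 ≤ N * ε := by positivity
  rcases max_cases (-Real.log 2) (pressure (lam / T) - 1 / T) with ⟨h, -⟩ | ⟨h, -⟩ <;> rw [h]
  · refine le_trans ?_ (exp_average_le_quantumPartitionFunction N T lam _)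
    have h3 : ((2 : ℝ) ^ N)⁻¹ * ∑ σ, U N σ ω ≤ N * ε := by
      refine average_le_of_partitionFunction_le hε (h2.trans (le_of_eq ?_))
      congr 1
      ring
    have h4 := mul_le_mul_of_nonneg_left h3 hβ
    rw [two_pow_eq_exp] at h4 ⊢
    rw [← Real.exp_neg] at h4 ⊢
    rw [← Real.exp_add]
    exact Real.exp_le_exp.2 (by linarith)
  · refine le_trans ?_ (exp_mul_partitionFunction_le_quantumPartitionFunction hT lam _)
    refine le_trans ?_ (mul_le_mul_of_nonneg_left h1 (Real.exp_pos _).le)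
    rw [← Real.exp_add]
    refine Real.exp_le_exp.2 ?_
    have h5 : (N : ℝ) / T = N * (1 / T) := by ring
    rw [h5]
    linarith

theorem IsREM.ae_eventually_quantumPartitionFunction_le [IsProbabilityMeasure P]
    (hU : IsREM P U) {T lam ε : ℝ} (hT : 0 < T) (hlam : 0 ≤ lam) (hε : 0 < ε) (hε1 : ε ≤ 1) :
    ∀ᵐ ω ∂P, ∀ᶠ N : ℕ in atTop,
      quantumPartitionFunction N T lam (fun σ => U N σ ω) ≤
        Real.exp (N * (max (-Real.log 2) (pressure (lam / T) - 1 / T) +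
          (2 + 2 / T + lam / T) * ε)) := by
  have hβ : 0 ≤ lam / T := by positivity
  have hε2 : 0 < ε ^ 2 / 4 := by positivity
  have hlim := (tendsto_natCast_atTop_atTop (R := ℝ)).const_mul_atTop hε2
  have hsmall : ∀ᶠ N : ℕ in atTop, Real.exp (-(ε ^ 2 / 4 * N)) ≤ ε ^ 2 :=
    (Real.tendsto_exp_neg_atTop_nhds_zero.comp hlim).eventually_le_const (by positivity)
  have hlarge : ∀ᶠ N : ℕ in atTop, Real.log 3 ≤ ε * N :=
    ((tendsto_natCast_atTop_atTop (R := ℝ)).const_mul_atTop hε).eventually_ge_atTop _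
  filter_upwards [hU.ae_eventually_partitionFunction_le_pressure (lam / T) hε,
    hU.ae_eventually_partitionFunction_le ε hε2] with ω h1 h2
  filter_upwards [h1, h2, hsmall, hlarge] with N h1 h2 h3 h4
  set M := max (-Real.log 2) (pressure (lam / T) - 1 / T) with hM
  have hM1 : -Real.log 2 ≤ M := le_max_left _ _
  have hM2 : pressure (lam / T) - 1 / T ≤ M := le_max_right _ _
  have hp := pressure_nonneg (β := lam / T)
  have hN : (0 : ℝ) ≤ N := N.cast_nonneg
  have hT' : 0 ≤ 1 / T := by positivity
  -- the parameter `s = ε` in the exponential Chebyshev bound is optimal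
  have hL : ∑ σ with U N σ ω < -(ε * N), flatState N σ ^ 2 ≤ ε ^ 2 := by
    refine (sum_flatState_sq_le hε.le (ε * N) _).trans (le_trans ?_ h3)
    refine (mul_le_mul_of_nonneg_left h2 (Real.exp_pos _).le).trans ?_
    rw [← Real.exp_add]
    exact Real.exp_le_exp.2 (le_of_eq (by ring))
  refine (quantumPartitionFunction_le hT hlam hε _ hL).trans ?_
  have hsum : partitionFunction N (lam / T) (fun σ => U N σ ω) +
      Real.exp (N / T - N * Real.log 2) + 1 ≤ 3 * Real.exp (N * (M + 1 / T + ε)) := by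
    have e1 : Real.exp (N * (pressure (lam / T) + ε)) ≤ Real.exp (N * (M + 1 / T + ε)) :=
      Real.exp_le_exp.2 (mul_le_mul_of_nonneg_left (by linarith) hN)
    have e2 : Real.exp (N / T - N * Real.log 2) ≤ Real.exp (N * (M + 1 / T + ε)) := by
      refine Real.exp_le_exp.2 ?_
      have : (N : ℝ) / T - N * Real.log 2 = N * (-Real.log 2 + 1 / T) := by ring
      rw [this]
      exact mul_le_mul_of_nonneg_left (by linarith) hN
    have e3 : 1 ≤ Real.exp (N * (M + 1 / T + ε)) :=
      Real.one_le_exp (mul_nonneg hN (by linarith))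
    linarith
  have h5 : (3 : ℝ) ≤ Real.exp (ε * N) := by
    rw [← Real.exp_log (show (0 : ℝ) < 3 by norm_num)]
    exact Real.exp_le_exp.2 h4
  calc Real.exp (-(N / T) + N / T * (ε + ε ^ 2) + lam / T * (ε * N)) *
        (partitionFunction N (lam / T) (fun σ => U N σ ω) +
          Real.exp (N / T - N * Real.log 2) + 1)
      ≤ Real.exp (-(N / T) + N / T * (ε + ε ^ 2) + lam / T * (ε * N)) *
        (Real.exp (ε * N) * Real.exp (N * (M + 1 / T + ε))) := by
        refine mul_le_mul_of_nonneg_left (hsum.trans ?_) (Real.exp_pos _).le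
        exact mul_le_mul_of_nonneg_right h5 (Real.exp_pos _).le
    _ ≤ Real.exp (N * (M + (2 + 2 / T + lam / T) * ε)) := by
        rw [← Real.exp_add, ← Real.exp_add]
        refine Real.exp_le_exp.2 ?_
        have h6 : N * (1 / T) * ε ^ 2 ≤ N * (1 / T) * ε := by
          refine mul_le_mul_of_nonneg_left ?_ (by positivity)
          nlinarith
        have e1 : (N : ℝ) / T = N * (1 / T) := by ring
        have e2 : (2 : ℝ) / T = 2 * (1 / T) := by ring
        rw [e1, e2]
        linarith

theorem ae_tendsto_of_forall_ae_eventually_abs_sub_le {X : ℕ → Ω → ℝ} {x : ℝ}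
    (h : ∀ δ > 0, ∀ᵐ ω ∂P, ∀ᶠ N in atTop, |X N ω - x| ≤ δ) :
    ∀ᵐ ω ∂P, Tendsto (fun N => X N ω) atTop (𝓝 x) := by
  have h1 : ∀ᵐ ω ∂P, ∀ k : ℕ, ∀ᶠ N in atTop, |X N ω - x| ≤ 1 / ((k : ℝ) + 1) :=
    ae_all_iff.2 fun k => h _ (by positivity)
  filter_upwards [h1] with ω hω
  refine Metric.tendsto_nhds.2 fun δ hδ => ?_
  obtain ⟨k, hk⟩ := exists_nat_one_div_lt hδ
  filter_upwards [hω k] with N hN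
  rw [Real.dist_eq]
  exact hN.trans_lt hk

theorem IsREM.ae_tendsto_finiteFreeEnergy [IsProbabilityMeasure P] (hU : IsREM P U) {T lam : ℝ}
    (hT : 0 < T) (hlam : 0 ≤ lam) :
    ∀ᵐ ω ∂P, Tendsto (fun N : ℕ => finiteFreeEnergy N T lam (fun σ => U N σ ω)) atTop
      (𝓝 (max (-T * Real.log 2) (T * pressure (lam / T) - 1))) := by
  refine ae_tendsto_of_forall_ae_eventually_abs_sub_le fun δ hδ => ?_
  set M := max (-Real.log 2) (pressure (lam / T) - 1 / T) with hM
  have hTM : max (-T * Real.log 2) (T * pressure (lam / T) - 1) = T * M := by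
    rw [hM, mul_max_of_nonneg _ _ hT.le]
    congr 1
    · ring
    · field_simp
  set K := 2 + 2 / T + lam / T with hK
  have hK0 : 0 < K := by positivity
  have hKT : 0 < T * K := by positivity
  set ε := min 1 (δ / (T * K)) with hεdef
  have hε : 0 < ε := lt_min one_pos (div_pos hδ hKT)
  have hεδ : T * (K * ε) ≤ δ := by
    have : ε ≤ δ / (T * K) := min_le_right _ _
    rw [le_div_iff₀ hKT] at this
    linarith
  have hK1 : (1 + lam / T) * ε ≤ K * ε := by
    refine mul_le_mul_of_nonneg_right ?_ hε.le
    have : 0 ≤ 2 / T := by positivity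
    rw [hK]
    linarith
  filter_upwards [hU.ae_eventually_le_quantumPartitionFunction hT hlam hε,
    hU.ae_eventually_quantumPartitionFunction_le hT hlam hε (min_le_left _ _)] with ω h1 h2
  filter_upwards [h1, h2, eventually_ge_atTop 1] with N h1 h2 hN
  rw [← hM] at h1 h2
  have hN' : (0 : ℝ) < N := by exact_mod_cast hN
  set Z := quantumPartitionFunction N T lam (fun σ => U N σ ω)
  have hZ : 0 < Z := (Real.exp_pos _).trans_le h1
  have l1 : N * (M - (1 + lam / T) * ε) ≤ Real.log Z := (Real.le_log_iff_exp_le hZ).2 h1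
  have l2 : Real.log Z ≤ N * (M + K * ε) := (Real.log_le_iff_le_exp hZ).2 h2
  have hfin : finiteFreeEnergy N T lam (fun σ => U N σ ω) = T * (Real.log Z / N) := by
    rw [finiteFreeEnergy]
    change T / N * Real.log Z = _
    ring
  rw [hTM, hfin, ← mul_sub, abs_mul, abs_of_pos hT]
  refine le_trans (mul_le_mul_of_nonneg_left ?_ hT.le) hεδ
  have m1 : M - (1 + lam / T) * ε ≤ Real.log Z / N := by
    rw [le_div_iff₀ hN']; linarith
  have m2 : Real.log Z / N ≤ M + K * ε := by
    rw [div_le_iff₀ hN']; linarith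
  rw [abs_le]
  constructor <;> linarith

end Limit

/-! ### The phase diagram -/

section Phases

theorem log_two_eq : Real.log 2 = betaC ^ 2 / 2 := by rw [betaC_sq]; ring

theorem mem_quantumParamagnet {T lam : ℝ} :
    (T, lam) ∈ quantumParamagnet ↔ 0 < T ∧ 0 ≤ lam ∧ ((T * betaC ^ 2 ≤ 1 ∧ lam * betaC < 1) ∨
      (1 < T * betaC ^ 2 ∧ lam ^ 2 < 2 * T - T ^ 2 * betaC ^ 2)) := by
  have hb := betaC_pos
  have h1 : 2 * T * (1 - T * Real.log 2) = 2 * T - T ^ 2 * betaC ^ 2 := by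
    rw [log_two_eq]; ring
  simp only [quantumParamagnet, Set.mem_ofPred_eq]
  rw [h1, le_div_iff₀ (by positivity), lt_div_iff₀ hb, div_lt_iff₀ (by positivity)]

theorem mem_spinGlass {T lam : ℝ} :
    (T, lam) ∈ spinGlass ↔ 0 < T ∧ 0 ≤ lam ∧ 1 < lam * betaC ∧ betaC * T < lam := by
  simp only [spinGlass, Set.mem_ofPred_eq]
  rw [div_lt_iff₀ betaC_pos]

theorem mem_classicalParamagnet {T lam : ℝ} :
    (T, lam) ∈ classicalParamagnet ↔ 0 < T ∧ 0 ≤ lam ∧ lam < betaC * T ∧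
      2 * T - T ^ 2 * betaC ^ 2 < lam ^ 2 := by
  have h1 : 2 * T * (1 - T * Real.log 2) = 2 * T - T ^ 2 * betaC ^ 2 := by
    rw [log_two_eq]; ring
  simp only [classicalParamagnet, Set.mem_ofPred_eq]
  rw [h1]

theorem mul_pressure_of_le {T lam : ℝ} (hT : 0 < T) (h : lam ≤ betaC * T) :
    T * pressure (lam / T) - 1 = lam ^ 2 / (2 * T) - 1 := by
  rw [pressure, if_pos ((div_le_iff₀ hT).2 h)]
  field_simp

theorem mul_pressure_of_lt {T lam : ℝ} (hT : 0 < T) (h : betaC * T < lam) :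
    T * pressure (lam / T) - 1 = lam * betaC - T * Real.log 2 - 1 := by
  rw [pressure, if_neg (not_le.2 ((lt_div_iff₀ hT).2 h))]
  field_simp

theorem mul_pressure_lt_of_mem_quantumParamagnet {T lam : ℝ} (h : (T, lam) ∈ quantumParamagnet) :
    T * pressure (lam / T) - 1 < -T * Real.log 2 := by
  obtain ⟨hT, hlam, h⟩ := mem_quantumParamagnet.1 h
  have hb := betaC_pos
  have hle : ∀ {x : ℝ}, x < 2 * T - T ^ 2 * betaC ^ 2 → x / (2 * T) - 1 < -T * Real.log 2 := by
    intro x hx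
    rw [log_two_eq, sub_lt_iff_lt_add, div_lt_iff₀ (by positivity)]
    linarith
  rcases le_or_gt lam (betaC * T) with h1 | h1
  · rw [mul_pressure_of_le hT h1]
    refine hle ?_
    rcases h with ⟨h2, h3⟩ | ⟨h2, h3⟩
    · have e1 : lam ^ 2 ≤ lam * (betaC * T) := by
        rw [sq]; exact mul_le_mul_of_nonneg_left h1 hlam
      have e2 : lam * betaC * T < 1 * T := mul_lt_mul_of_pos_right h3 hT
      have e3 : T * betaC ^ 2 * T ≤ 1 * T := mul_le_mul_of_nonneg_right h2 hT.le
      linarith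
    · exact h3
  · rw [mul_pressure_of_lt hT h1]
    rcases h with ⟨h2, h3⟩ | ⟨h2, h3⟩
    · linarith
    · exfalso
      have e1 : (betaC * T) ^ 2 < lam ^ 2 := by gcongr
      have e2 := mul_lt_mul_of_pos_right h2 hT
      linarith

/-- The sign of `lam` plays no role in this formula, so that it holds near every point of the
spin glass phase. -/
theorem freeEnergy_eq_of_spinGlass {T lam : ℝ} (hT : 0 < T) (h1 : 1 < lam * betaC)
    (h2 : betaC * T < lam) : freeEnergy T lam = lam * betaC - T * Real.log 2 - 1 := by
  rw [freeEnergy, mul_pressure_of_lt hT h2]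
  exact max_eq_right (by linarith)

/-- The sign of `lam` plays no role in this formula, so that it holds near every point of the
classical paramagnetic phase, including those with `lam = 0`. -/
theorem freeEnergy_eq_of_classicalParamagnet {T lam : ℝ} (hT : 0 < T) (h1 : lam < betaC * T)
    (h2 : 2 * T - T ^ 2 * betaC ^ 2 < lam ^ 2) : freeEnergy T lam = lam ^ 2 / (2 * T) - 1 := by
  rw [freeEnergy, mul_pressure_of_le hT h1.le]
  refine max_eq_right ?_
  rw [log_two_eq, le_sub_iff_add_le, le_div_iff₀ (by positivity)]
  linarith

theorem freeEnergy_eq_of_mem_quantumParamagnet {T lam : ℝ} (h : (T, lam) ∈ quantumParamagnet) :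
    freeEnergy T lam = -T * Real.log 2 :=
  max_eq_left (mul_pressure_lt_of_mem_quantumParamagnet h).le

theorem disjoint_quantumParamagnet_spinGlass : Disjoint quantumParamagnet spinGlass := by
  rw [Set.disjoint_left]
  rintro ⟨T, lam⟩ hq hs
  obtain ⟨hT, hlam, h⟩ := mem_quantumParamagnet.1 hq
  obtain ⟨-, -, h1, h2⟩ := mem_spinGlass.1 hs
  rcases h with ⟨-, h3⟩ | ⟨h3, h4⟩
  · linarith
  · have hb := betaC_pos
    have e1 : (betaC * T) ^ 2 < lam ^ 2 := by gcongr
    have e2 := mul_lt_mul_of_pos_right h3 hT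
    linarith

theorem disjoint_quantumParamagnet_classicalParamagnet :
    Disjoint quantumParamagnet classicalParamagnet := by
  rw [Set.disjoint_left]
  rintro ⟨T, lam⟩ hq hc
  obtain ⟨hT, hlam, h⟩ := mem_quantumParamagnet.1 hq
  obtain ⟨-, -, h1, h2⟩ := mem_classicalParamagnet.1 hc
  rcases h with ⟨h3, -⟩ | ⟨-, h4⟩
  · have e1 : lam ^ 2 < (betaC * T) ^ 2 := by gcongr
    have e2 := mul_le_mul_of_nonneg_right h3 hT.le
    linarith
  · linarith

theorem disjoint_spinGlass_classicalParamagnet : Disjoint spinGlass classicalParamagnet := by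
  rw [Set.disjoint_left]
  rintro ⟨T, lam⟩ hs hc
  exact lt_asymm (mem_spinGlass.1 hs).2.2.2 (mem_classicalParamagnet.1 hc).2.2.1

theorem quantumParamagnet_nonempty : quantumParamagnet.Nonempty := by
  have hb := betaC_pos
  refine ⟨(1 / betaC ^ 2, 0), mem_quantumParamagnet.2 ⟨by positivity, le_rfl, Or.inl ⟨?_, ?_⟩⟩⟩
  · rw [one_div_mul_cancel (by positivity)]
  · simp

theorem spinGlass_nonempty : spinGlass.Nonempty := by
  have hb := betaC_pos
  refine ⟨(1, betaC + 1 / betaC), mem_spinGlass.2 ⟨one_pos, by positivity, ?_, ?_⟩⟩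
  · rw [add_mul, one_div_mul_cancel hb.ne']
    have := mul_pos hb hb
    linarith
  · have := one_div_pos.2 hb
    linarith

theorem classicalParamagnet_nonempty : classicalParamagnet.Nonempty := by
  have hb := betaC_pos
  refine ⟨(2 / betaC ^ 2, 1 / betaC), mem_classicalParamagnet.2
    ⟨by positivity, by positivity, ?_, ?_⟩⟩
  · rw [div_lt_iff₀ hb]
    have : betaC * (2 / betaC ^ 2) * betaC = 2 := by field_simp
    rw [this]
    norm_num
  · have : 2 * (2 / betaC ^ 2) - (2 / betaC ^ 2) ^ 2 * betaC ^ 2 = 0 := by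
      field_simp
      ring
    rw [this]
    positivity

theorem continuous_pressure : Continuous pressure := by
  unfold pressure
  refine Continuous.if_le (by fun_prop) (by fun_prop) continuous_id continuous_const ?_
  rintro β rfl
  rw [log_two_eq]
  ring

/-! ### Analyticity -/

theorem analyticAt_freeEnergy_of_mem_quantumParamagnet {T lam : ℝ}
    (h : (T, lam) ∈ quantumParamagnet) :
    AnalyticAt ℝ (fun p : ℝ × ℝ => freeEnergy p.1 p.2) (T, lam) := by
  have hT : T ≠ 0 := h.1.ne'
  have hcont : ContinuousAt (fun p : ℝ × ℝ => p.1 * pressure (p.2 / p.1) - 1) (T, lam) :=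
    (continuousAt_fst.mul (continuous_pressure.continuousAt.comp
      (continuousAt_snd.div continuousAt_fst hT))).sub continuousAt_const
  have hcont' : ContinuousAt (fun p : ℝ × ℝ => -p.1 * Real.log 2) (T, lam) := by fun_prop
  have hev := hcont.eventually_lt hcont' (mul_pressure_lt_of_mem_quantumParamagnet h)
  have han : AnalyticAt ℝ (fun p : ℝ × ℝ => -p.1 * Real.log 2) (T, lam) :=
    analyticAt_fst.neg.mul analyticAt_const
  refine han.congr ?_
  filter_upwards [hev] with p hp
  exact (max_eq_left hp.le).symm

theorem analyticAt_freeEnergy_of_mem_spinGlass {T lam : ℝ} (h : (T, lam) ∈ spinGlass) :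
    AnalyticAt ℝ (fun p : ℝ × ℝ => freeEnergy p.1 p.2) (T, lam) := by
  obtain ⟨hT, -, h1, h2⟩ := mem_spinGlass.1 h
  have han : AnalyticAt ℝ (fun p : ℝ × ℝ => p.2 * betaC - p.1 * Real.log 2 - 1) (T, lam) :=
    ((analyticAt_snd.mul analyticAt_const).sub (analyticAt_fst.mul analyticAt_const)).sub
      analyticAt_const
  refine han.congr ?_
  have c1 : ContinuousAt (fun p : ℝ × ℝ => p.1) (T, lam) := continuousAt_fst
  have c2 : ContinuousAt (fun p : ℝ × ℝ => p.2) (T, lam) := continuousAt_snd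
  filter_upwards [continuousAt_const.eventually_lt c1 hT,
    continuousAt_const.eventually_lt (c2.mul continuousAt_const) h1,
    (continuousAt_const.mul c1).eventually_lt c2 h2] with p e1 e2 e3
  exact (freeEnergy_eq_of_spinGlass e1 e2 e3).symm

theorem analyticAt_freeEnergy_of_mem_classicalParamagnet {T lam : ℝ}
    (h : (T, lam) ∈ classicalParamagnet) :
    AnalyticAt ℝ (fun p : ℝ × ℝ => freeEnergy p.1 p.2) (T, lam) := by
  obtain ⟨hT, -, h1, h2⟩ := mem_classicalParamagnet.1 h
  have han : AnalyticAt ℝ (fun p : ℝ × ℝ => p.2 ^ 2 / (2 * p.1) - 1) (T, lam) :=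
    ((analyticAt_snd.pow 2).div (analyticAt_const.mul analyticAt_fst)
      (mul_ne_zero two_ne_zero hT.ne')).sub analyticAt_const
  refine han.congr ?_
  have c1 : ContinuousAt (fun p : ℝ × ℝ => p.1) (T, lam) := continuousAt_fst
  have c2 : ContinuousAt (fun p : ℝ × ℝ => p.2) (T, lam) := continuousAt_snd
  have c3 : ContinuousAt (fun p : ℝ × ℝ => 2 * p.1 - p.1 ^ 2 * betaC ^ 2) (T, lam) := by fun_prop
  filter_upwards [continuousAt_const.eventually_lt c1 hT,
    c2.eventually_lt (continuousAt_const.mul c1) h1,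
    c3.eventually_lt (c2.pow 2) h2] with p e1 e2 e3
  exact (freeEnergy_eq_of_classicalParamagnet e1 e2 e3).symm

/-- An analytic function given by analytic expressions on the two sides of a point forces these
expressions to agree. -/
theorem eventually_eq_of_analyticAt_of_sides {h A B : ℝ → ℝ} {x : ℝ} (hh : AnalyticAt ℝ h x)
    (hA : AnalyticAt ℝ A x) (hB : AnalyticAt ℝ B x) (hr : ∀ᶠ y in 𝓝[>] x, h y = A y)
    (hl : ∀ᶠ y in 𝓝[<] x, h y = B y) : ∀ᶠ y in 𝓝[>] x, A y = B y := by
  have h1 := (hh.frequently_eq_iff_eventually_eq hA).1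
    (hr.frequently.filter_mono (nhdsWithin_mono x fun _ hy => ne_of_gt hy))
  have h2 := (hh.frequently_eq_iff_eventually_eq hB).1
    (hl.frequently.filter_mono (nhdsWithin_mono x fun _ hy => ne_of_lt hy))
  refine nhdsWithin_le_nhds ?_
  filter_upwards [h1, h2] with y e1 e2
  rw [← e1, e2]

/-- First-order transition between the quantum paramagnet and the spin glass: a kink in `lam`. -/
theorem not_analyticAt_freeEnergy_of_quantumParamagnet_spinGlass {T lam : ℝ} (hT : 0 < T)
    (h1 : T * betaC ^ 2 ≤ 1) (h2 : lam * betaC = 1) :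
    ¬ AnalyticAt ℝ (fun p : ℝ × ℝ => freeEnergy p.1 p.2) (T, lam) := by
  intro han
  have hb := betaC_pos
  have hlam : 0 < lam := pos_of_mul_pos_left (h2 ▸ one_pos) hb.le
  have hline : AnalyticAt ℝ (fun x => freeEnergy T x) lam :=
    han.comp (analyticAt_const.prod analyticAt_id : AnalyticAt ℝ (fun x : ℝ => (T, x)) lam)
  have hbT : betaC * T ≤ lam := by
    refine le_of_mul_le_mul_right ?_ hb
    linarith
  have hr : ∀ᶠ x in 𝓝[>] lam, freeEnergy T x = x * betaC - T * Real.log 2 - 1 := by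
    filter_upwards [self_mem_nhdsWithin] with x hx
    have hx : lam < x := hx
    have := mul_lt_mul_of_pos_right hx hb
    exact freeEnergy_eq_of_spinGlass hT (by linarith) (by linarith)
  have hl : ∀ᶠ x in 𝓝[<] lam, freeEnergy T x = -T * Real.log 2 := by
    filter_upwards [self_mem_nhdsWithin, nhdsWithin_le_nhds (lt_mem_nhds hlam)] with x hx hx0
    have hx : x < lam := hx
    have := mul_lt_mul_of_pos_right hx hb
    exact freeEnergy_eq_of_mem_quantumParamagnet
      (mem_quantumParamagnet.2 ⟨hT, le_of_lt hx0, Or.inl ⟨h1, by linarith⟩⟩)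
  obtain ⟨x, hx, hlx⟩ := ((eventually_eq_of_analyticAt_of_sides hline
    (by fun_prop) analyticAt_const hr hl).and self_mem_nhdsWithin).exists
  have hlx : lam < x := hlx
  have := mul_lt_mul_of_pos_right hlx hb
  linarith

/-- Second-order transition between the spin glass and the classical paramagnet: the two
expressions in `lam` have contact of order exactly one. -/
theorem not_analyticAt_freeEnergy_of_spinGlass_classicalParamagnet {T lam : ℝ} (hT : 0 < T)
    (h1 : 1 < T * betaC ^ 2) (h2 : lam = betaC * T) :
    ¬ AnalyticAt ℝ (fun p : ℝ × ℝ => freeEnergy p.1 p.2) (T, lam) := by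
  intro han
  have hb := betaC_pos
  have hline : AnalyticAt ℝ (fun x => freeEnergy T x) lam :=
    han.comp (analyticAt_const.prod analyticAt_id : AnalyticAt ℝ (fun x : ℝ => (T, x)) lam)
  have hr : ∀ᶠ x in 𝓝[>] lam, freeEnergy T x = x * betaC - T * Real.log 2 - 1 := by
    filter_upwards [self_mem_nhdsWithin] with x hx
    have hx : lam < x := hx
    have := mul_lt_mul_of_pos_right hx hb
    refine freeEnergy_eq_of_spinGlass hT ?_ (by linarith)
    rw [h2] at this
    linarith
  have hl : ∀ᶠ x in 𝓝[<] lam, freeEnergy T x = x ^ 2 / (2 * T) - 1 := by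
    have hlt : 2 * T - T ^ 2 * betaC ^ 2 < lam ^ 2 := by
      have := mul_lt_mul_of_pos_right h1 hT
      rw [h2]
      linarith
    have hc : ContinuousAt (fun x : ℝ => x ^ 2) lam := by fun_prop
    filter_upwards [self_mem_nhdsWithin,
      nhdsWithin_le_nhds (continuousAt_const.eventually_lt hc hlt)] with x hx hx0
    have hx : x < lam := hx
    exact freeEnergy_eq_of_classicalParamagnet hT (by linarith) hx0
  obtain ⟨x, hx, hlx⟩ := ((eventually_eq_of_analyticAt_of_sides hline
    (by fun_prop) (by fun_prop) hr hl).and self_mem_nhdsWithin).exists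
  have hlx : lam < x := hlx
  -- the difference of the two expressions is `(x - lam)² / (2 T)`
  have h3 : (x - lam) ^ 2 = 0 := by
    rw [log_two_eq] at hx
    field_simp at hx
    rw [h2]
    linarith
  have h4 := pow_eq_zero_iff (two_ne_zero) |>.1 h3
  linarith

/-- First-order transition between the quantum and the classical paramagnet: a kink in `T`, also
at `lam = 0`, where the free energy has no kink in `lam`. -/
theorem not_analyticAt_freeEnergy_of_quantumParamagnet_classicalParamagnet {T lam : ℝ}
    (hT : 0 < T) (hlam : 0 ≤ lam) (h1 : 1 < T * betaC ^ 2)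
    (h2 : lam ^ 2 = 2 * T - T ^ 2 * betaC ^ 2) :
    ¬ AnalyticAt ℝ (fun p : ℝ × ℝ => freeEnergy p.1 p.2) (T, lam) := by
  intro han
  have hb := betaC_pos
  have hb2 : 0 < betaC ^ 2 := by positivity
  have hline : AnalyticAt ℝ (fun t => freeEnergy t lam) T :=
    AnalyticAt.comp (f := fun t : ℝ => (t, lam)) (x := T) han
      (analyticAt_id.prod analyticAt_const)
  have hbT : lam < betaC * T := by
    refine lt_of_pow_lt_pow_left₀ 2 (by positivity) ?_
    have := mul_lt_mul_of_pos_right h1 hT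
    rw [h2]
    linarith
  -- `t ↦ 2 t - t² β_c²` is strictly decreasing beyond `β_c⁻²`
  have hdec : ∀ {s t : ℝ}, 1 < s * betaC ^ 2 → s < t →
      2 * t - t ^ 2 * betaC ^ 2 < 2 * s - s ^ 2 * betaC ^ 2 := by
    intro s t hs hst
    have e1 := mul_lt_mul_of_pos_right hst hb2
    have e2 : 0 < (t - s) * ((s + t) * betaC ^ 2 - 2) :=
      mul_pos (by linarith) (by linarith)
    linarith
  have hr : ∀ᶠ t in 𝓝[>] T, freeEnergy t lam = lam ^ 2 / (2 * t) - 1 := by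
    filter_upwards [self_mem_nhdsWithin] with t ht
    have ht : T < t := ht
    have e1 := mul_lt_mul_of_pos_left ht hb
    exact freeEnergy_eq_of_classicalParamagnet (hT.trans ht) (by linarith)
      (h2 ▸ hdec h1 ht)
  have hl : ∀ᶠ t in 𝓝[<] T, freeEnergy t lam = -t * Real.log 2 := by
    have hc : ContinuousAt (fun t : ℝ => t * betaC ^ 2) T := by fun_prop
    filter_upwards [self_mem_nhdsWithin, nhdsWithin_le_nhds (lt_mem_nhds hT),
      nhdsWithin_le_nhds (continuousAt_const.eventually_lt hc h1)] with t ht ht0 ht1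
    exact freeEnergy_eq_of_mem_quantumParamagnet
      (mem_quantumParamagnet.2 ⟨ht0, hlam, Or.inr ⟨ht1, h2 ▸ hdec ht1 ht⟩⟩)
  have hA : AnalyticAt ℝ (fun t : ℝ => lam ^ 2 / (2 * t) - 1) T :=
    (analyticAt_const.div (analyticAt_const.mul analyticAt_id)
      (mul_ne_zero two_ne_zero hT.ne')).sub analyticAt_const
  obtain ⟨t, ht, hTt⟩ := ((eventually_eq_of_analyticAt_of_sides hline
    hA (by fun_prop) hr hl).and self_mem_nhdsWithin).exists
  have hTt : T < t := hTt
  have ht0 : 0 < t := hT.trans hTt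
  have h3 := hdec h1 hTt
  rw [log_two_eq, sub_eq_iff_eq_add, div_eq_iff (by positivity)] at ht
  linarith

theorem analyticAt_freeEnergy_iff {T lam : ℝ} (hT : 0 < T) (hlam : 0 ≤ lam) :
    AnalyticAt ℝ (fun p : ℝ × ℝ => freeEnergy p.1 p.2) (T, lam) ↔
      (T, lam) ∈ quantumParamagnet ∪ spinGlass ∪ classicalParamagnet := by
  constructor
  · intro han
    by_contra hmem
    simp only [Set.mem_union, not_or] at hmem
    obtain ⟨⟨hq, hs⟩, hc⟩ := hmem
    rw [mem_quantumParamagnet] at hq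
    rw [mem_spinGlass] at hs
    rw [mem_classicalParamagnet] at hc
    simp only [hT, hlam, true_and, not_or, not_and, not_lt] at hq hs hc
    have hb := betaC_pos
    rcases le_or_gt (T * betaC ^ 2) 1 with h1 | h1
    · have h2 := hq.1 h1
      rcases h2.lt_or_eq with h3 | h3
      · have h4 : lam * betaC ≤ betaC * T * betaC := mul_le_mul_of_nonneg_right (hs h3) hb.le
        linarith
      · exact not_analyticAt_freeEnergy_of_quantumParamagnet_spinGlass hT h1 h3.symm han
    · have h2 := hq.2 h1
      have h3 : lam ≤ betaC * T := by
        by_contra h4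
        rw [not_le] at h4
        have h5 := mul_lt_mul_of_pos_right h4 hb
        exact absurd (hs (by linarith)) (not_le.2 h4)
      rcases h3.lt_or_eq with h4 | h4
      · exact not_analyticAt_freeEnergy_of_quantumParamagnet_classicalParamagnet hT hlam h1
          (le_antisymm (hc h4) h2) han
      · exact not_analyticAt_freeEnergy_of_spinGlass_classicalParamagnet hT h1 h4 han
  · rintro ((h | h) | h)
    · exact analyticAt_freeEnergy_of_mem_quantumParamagnet h
    · exact analyticAt_freeEnergy_of_mem_spinGlass h
    · exact analyticAt_freeEnergy_of_mem_classicalParamagnet h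

end Phases

end AllToAllQREM

theorem mainTheorem3 {Ω : Type*} [MeasurableSpace Ω] (P : MeasureTheory.Measure Ω)
    [MeasureTheory.IsProbabilityMeasure P]
    (U : (N : ℕ) → AllToAllQREM.Config N → Ω → ℝ) (hU : AllToAllQREM.IsREM P U) :
    -- the limit of the free energy, for almost all realisations of the random energy model
    (∀ T lam : ℝ, 0 < T → 0 ≤ lam →
      ∀ᵐ ω ∂P, Filter.Tendsto
        (fun N : ℕ => AllToAllQREM.finiteFreeEnergy N T lam (fun σ => U N σ ω))
        Filter.atTop
        (nhds (max (-T * Real.log 2) (T * AllToAllQREM.pressure (lam / T) - 1)))) ∧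
    -- the three phases are non-empty and pairwise disjoint
    AllToAllQREM.quantumParamagnet.Nonempty ∧
    AllToAllQREM.spinGlass.Nonempty ∧
    AllToAllQREM.classicalParamagnet.Nonempty ∧
    Disjoint AllToAllQREM.quantumParamagnet AllToAllQREM.spinGlass ∧
    Disjoint AllToAllQREM.quantumParamagnet AllToAllQREM.classicalParamagnet ∧
    Disjoint AllToAllQREM.spinGlass AllToAllQREM.classicalParamagnet ∧
    -- the free energy in each of them
    (∀ T lam : ℝ, (T, lam) ∈ AllToAllQREM.quantumParamagnet →
      AllToAllQREM.freeEnergy T lam = -T * Real.log 2) ∧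
    (∀ T lam : ℝ, (T, lam) ∈ AllToAllQREM.spinGlass →
      AllToAllQREM.freeEnergy T lam = lam * AllToAllQREM.betaC - T * Real.log 2 - 1) ∧
    (∀ T lam : ℝ, (T, lam) ∈ AllToAllQREM.classicalParamagnet →
      AllToAllQREM.freeEnergy T lam = lam ^ 2 / (2 * T) - 1) ∧
    -- the free energy is singular exactly on the boundaries between them
    (∀ T lam : ℝ, 0 < T → 0 ≤ lam →
      (AnalyticAt ℝ (fun p : ℝ × ℝ => AllToAllQREM.freeEnergy p.1 p.2) (T, lam) ↔
        (T, lam) ∈ AllToAllQREM.quantumParamagnet ∪ AllToAllQREM.spinGlass ∪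
          AllToAllQREM.classicalParamagnet)) := by
  open AllToAllQREM in
  exact ⟨fun _ _ hT hlam => hU.ae_tendsto_finiteFreeEnergy hT hlam,
    quantumParamagnet_nonempty, spinGlass_nonempty, classicalParamagnet_nonempty,
    disjoint_quantumParamagnet_spinGlass, disjoint_quantumParamagnet_classicalParamagnet,
    disjoint_spinGlass_classicalParamagnet,
    fun _ _ h => freeEnergy_eq_of_mem_quantumParamagnet h,
    fun _ _ h => freeEnergy_eq_of_spinGlass h.1 (mem_spinGlass.1 h).2.2.1 h.2.2.2,
    fun _ _ h => freeEnergy_eq_of_classicalParamagnet h.1 h.2.2.1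
      (mem_classicalParamagnet.1 h).2.2.2,
    fun _ _ hT hlam => analyticAt_freeEnergy_iff hT hlam⟩
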